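/- Let $\Gamma=\mathrm{Gal}(\mathbb C/\mathbb R)=\{1,\gamma\}$. By a real algebraic group we mean a group scheme $\mathbf G$ of finite type over $\mathbb R$, not necessarily linear, connected or commutative. Let $\mathbf G(\mathbb R)^0$ be the identity component of $\mathbf G(\mathbb R)$ for the Hausdorff topology, and put $\pi_0\mathbf G(\mathbb R)=\mathbf G(\mathbb R)/\mathbf G(\mathbb R)^0$. Let $H^1\mathbf G=H^1(\Gamma,\mathbf G(\mathbb C))$ be the pointed set of $1$-cocycles $\{a\in\mathbf G(\mathbb C)\mid a\cdot{}^\gamma a=1\}$ modulo the equivalence relation $a\sim a'\cdot a\cdot({}^\gamma a')^{-1}$ ($a'\in\mathbf G(\mathbb C)$), with neutral element $[1]$. Let $1\to\mathbf A\xrightarrow{i}\mathbf B\xrightarrow{j}\mathbf C\to1$ be a short exact sequence of real algebraic groups (that is, $j$ is faithfully flat and $i$ is a kernel of $j$). Let $\delta\colon\mathbf C(\mathbb R)\to H^1\mathbf A$ be the connecting map: for $c\in\mathbf C(\mathbb R)$, choose $b\in\mathbf B(\mathbb C)$ with $j(b)=c$ and put $\delta(c)=[a]$, where $a\in\mathbf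 A(\mathbb C)$ is the cocycle with $i(a)=b^{-1}\cdot{}^\gamma b$; this does not depend on the choice of $b$. Then: (i) The map $\delta$ induces a map $\delta^0\colon\pi_0\mathbf C(\mathbb R)\to H^1\mathbf A$, that is, $\delta^0[c]=\delta(c)$ for all $c\in\mathbf C(\mathbb R)$. (ii) The sequence of pointed sets $$\pi_0\mathbf A(\mathbb R)\xrightarrow{i_*^0}\pi_0\mathbf B(\mathbb R)\xrightarrow{j_*^0}\pi_0\mathbf C(\mathbb R)\xrightarrow{\delta^0}H^1\mathbf A\xrightarrow{i_*^1}H^1\mathbf B\xrightarrow{j_*^1}H^1\mathbf C$$ is exact, that is, at each of the four inner terms the preimage of the neutral element under the outgoing map equals the image of the incoming map. Here $i_*^0,j_*^0,i_*^1,j_*^1$ are the maps induced by $i$ and $j$. -/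

import Mathlib

open CategoryTheory CategoryTheory.Limits AlgebraicGeometry
open MonoidalCategory CartesianMonoidalCategory MonObj

noncomputable section

/-! Real algebraic groups are group objects in schemes over `Spec ℝ` (of finite type over `ℝ`, an
assumption that is made where it is needed); homomorphisms are morphisms `f` over `Spec ℝ` with
`[IsMonHom f]`.  No group is assumed to be affine, connected or commutative. -/

namespace RealGrp

/-- The category of schemes over `ℝ`. -/
abbrev RSch := Over (Spec (.of ℝ))

/-- `Spec K` as a scheme over `ℝ`. -/
abbrev specOver (K : Type) [CommRing K] [Algebra ℝ K] : RSch :=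
  Over.mk (Spec.map (CommRingCat.ofHom (algebraMap ℝ K)))

/-- The set `X(K)` of `K`-points of a scheme `X` over `ℝ`.  If `X` is a group scheme, this is a
group under pointwise multiplication. -/
abbrev Pt (K : Type) [CommRing K] [Algebra ℝ K] (X : RSch) : Type := specOver K ⟶ X

/-- The map `X(K) → Y(K)` given by a morphism `X ⟶ Y`. -/
abbrev ptMap (K : Type) [CommRing K] [Algebra ℝ K] {X Y : RSch} (f : X ⟶ Y) (x : Pt K X) :
    Pt K Y := x ≫ f

/-- The homomorphism `G(K) → H(K)` given by a homomorphism of group schemes. -/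
abbrev ptHom (K : Type) [CommRing K] [Algebra ℝ K] {G H : RSch} [GrpObj G] [GrpObj H] (f : G ⟶ H)
    [IsMonHom f] : Pt K G →* Pt K H := IsMonHom.monoidHom f (specOver K)

/-! ### The Hausdorff topology on real points -/

/-- For an open subscheme `U`, a regular function `s` on `U` and a set `W` of real numbers, the set
of those real points `x` which lie in `U` and satisfy `s(x) ∈ W`. -/
def basicSet {X : RSch} (U : X.left.Opens) (s : Γ(X.left, U)) (W : Set ℝ) : Set (Pt ℝ X) :=
  {x | ∃ h : ⊤ ≤ x.left ⁻¹ᵁ U,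
    (Scheme.ΓSpecIso (.of ℝ)).hom.hom ((x.left.appLE U ⊤ h).hom s) ∈ W}

/-- The usual (Hausdorff) topology on `X(ℝ)`: the coarsest one for which, for all opens `U` of `X`
and all regular functions `s` on `U`, the set `U(ℝ)` is open and `s : U(ℝ) → ℝ` is continuous. -/
instance realTopology (X : RSch) : TopologicalSpace (Pt ℝ X) :=
  TopologicalSpace.generateFrom
    {S | ∃ (U : X.left.Opens) (s : Γ(X.left, U)) (W : Set ℝ), IsOpen W ∧ S = basicSet U s W}

theorem continuous_ptMap {X Y : RSch} (f : X ⟶ Y) : Continuous (ptMap ℝ f) := by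
  refine continuous_generateFrom_iff.2 ?_
  rintro _ ⟨U, s, W, hW, rfl⟩
  refine TopologicalSpace.isOpen_generateFrom_of_mem
    ⟨f.left ⁻¹ᵁ U, (f.left.app U).hom s, W, hW, ?_⟩
  ext x
  simp only [basicSet, Set.mem_preimage, Set.mem_ofPred_eq]
  refine exists_congr fun h => ?_
  have : ((x ≫ f).left.appLE U ⊤ h).hom s =
      (x.left.appLE (f.left ⁻¹ᵁ U) ⊤ h).hom ((f.left.app U).hom s) := by
    have := Scheme.Hom.comp_appLE x.left f.left U ⊤ h
    exact congr($(this).hom s)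
  change _ ∈ W ↔ _ ∈ W
  rw [this]

/-- The structure morphism `X ⟶ Spec ℝ`. -/
def toSpec (X : RSch) : X ⟶ specOver ℝ :=
  Over.homMk X.hom (by
    have : CommRingCat.ofHom (algebraMap ℝ ℝ) = 𝟙 (CommRingCat.of ℝ) := rfl
    simp [this])

theorem pt_toSpec {X : RSch} (x : Pt ℝ X) : x ≫ toSpec X = 𝟙 _ := by
  ext1
  have h := Over.w x
  have : CommRingCat.ofHom (algebraMap ℝ ℝ) = 𝟙 (CommRingCat.of ℝ) := rfl
  simp only [Over.mk_hom, this, Spec.map_id] at h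
  exact h

section Component

variable (G : RSch) [GrpObj G]

theorem continuous_mulLeft (g : Pt ℝ G) : Continuous (fun x : Pt ℝ G => g * x) := by
  have h := continuous_ptMap ((toSpec G ≫ g) * 𝟙 G)
  refine h.congr fun x => ?_
  rw [ptMap, MonObj.comp_mul, ← Category.assoc, pt_toSpec, Category.id_comp, Category.comp_id]

theorem continuous_mulRight (g : Pt ℝ G) : Continuous (fun x : Pt ℝ G => x * g) := by
  have h := continuous_ptMap (𝟙 G * (toSpec G ≫ g))
  refine h.congr fun x => ?_
  rw [ptMap, MonObj.comp_mul, ← Category.assoc, pt_toSpec, Category.id_comp, Category.comp_id]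

theorem continuous_inv : Continuous (fun x : Pt ℝ G => x⁻¹) := by
  have h := continuous_ptMap ((𝟙 G)⁻¹)
  refine h.congr fun x => ?_
  rw [ptMap, GrpObj.comp_inv, Category.comp_id]

/-- The identity component `G(ℝ)⁰`. -/
def identityComponent : Subgroup (Pt ℝ G) where
  carrier := connectedComponent (1 : Pt ℝ G)
  one_mem' := mem_connectedComponent
  mul_mem' {a b} ha hb := by
    have h := (continuous_mulLeft G a).image_connectedComponent_subset 1 ⟨b, hb, rfl⟩
    simp only [_root_.mul_one] at h
    rwa [connectedComponent_eq ha]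
  inv_mem' {a} ha := by
    have h := (continuous_inv G).image_connectedComponent_subset 1 ⟨a, ha, rfl⟩
    rwa [inv_one] at h

instance : (identityComponent G).Normal where
  conj_mem a ha g := by
    have h := ((continuous_mulRight G g⁻¹).comp
      (continuous_mulLeft G g)).image_connectedComponent_subset 1 ⟨a, ha, rfl⟩
    simp only [Function.comp_apply, _root_.mul_one, mul_inv_cancel] at h
    exact h

/-- The component group `π₀ G(ℝ) = G(ℝ) / G(ℝ)⁰`. -/
abbrev pi0 : Type := Pt ℝ G ⧸ identityComponent G

variable {G} {H : RSch} [GrpObj H]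

/-- The homomorphism `f_*⁰ : π₀ G(ℝ) → π₀ H(ℝ)`, `[g] ↦ [f(g)]`. -/
def pi0Map (f : G ⟶ H) [IsMonHom f] : pi0 G →* pi0 H :=
  QuotientGroup.map _ _ (ptHom ℝ f) fun a ha => by
    have h := (continuous_ptMap f).image_connectedComponent_subset 1 ⟨a, ha, rfl⟩
    rwa [ptMap, MonObj.one_comp] at h

end Component

/-! ### The first nonabelian cohomology of the group of order two -/

section Cohomology

/-- The 1-cocycles `a · ᵞa = 1` of a group `M` on which the nontrivial element `γ` of a group of
order two acts through `σ`. -/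
abbrev Z1 {M : Type} [Group M] (σ : M →* M) : Type := {a : M // a * σ a = 1}

/-- Two cocycles are cohomologous if `a₂ = a' · a₁ · (ᵞa')⁻¹` for some `a'`. -/
def cohomologous {M : Type} [Group M] (σ : M →* M) : Setoid (Z1 σ) where
  r a₁ a₂ := ∃ a' : M, a₂.1 = a' * a₁.1 * (σ a')⁻¹
  iseqv :=
    { refl := fun a => ⟨1, by simp⟩
      symm := by
        rintro a₁ a₂ ⟨x, hx⟩
        exact ⟨x⁻¹, by rw [hx, map_inv]; group⟩
      trans := by
        rintro a₁ a₂ a₃ ⟨x, hx⟩ ⟨y, hy⟩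
        exact ⟨y * x, by rw [hy, hx, map_mul]; group⟩ }

/-- The cohomology set `H¹(⟨γ⟩, M) = Z¹ / ∼`. -/
def H1 {M : Type} [Group M] (σ : M →* M) : Type := Quotient (cohomologous σ)

/-- The class of a cocycle. -/
def H1.mk {M : Type} [Group M] {σ : M →* M} (a : Z1 σ) : H1 σ := Quotient.mk (cohomologous σ) a

/-- The neutral element `[1]` of the cohomology set. -/
instance {M : Type} [Group M] (σ : M →* M) : One (H1 σ) := ⟨H1.mk ⟨1, by simp⟩⟩

/-- The map induced on cohomology by an equivariant homomorphism, `[a] ↦ [f(a)]`. -/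
def H1.map {M N : Type} [Group M] [Group N] {σ : M →* M} {τ : N →* N} (f : M →* N)
    (hf : ∀ m, f (σ m) = τ (f m)) : H1 σ → H1 τ :=
  Quotient.map' (s₁ := cohomologous σ) (s₂ := cohomologous τ)
    (fun a => ⟨f a.1, by rw [← hf, ← map_mul, a.2, map_one]⟩) (by
      rintro a₁ a₂ ⟨x, hx⟩
      exact ⟨f x, by simp [hx, hf]⟩)

end Cohomology

/-! ### Complex points, Galois cohomology and the connecting map -/

/-- Complex conjugation as an automorphism of `Spec ℂ` over `ℝ`. -/
def specConj : specOver ℂ ⟶ specOver ℂ :=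
  Over.homMk (Spec.map (CommRingCat.ofHom (starRingEnd ℂ))) (by
    change Spec.map _ ≫ Spec.map _ = Spec.map _
    rw [← Spec.map_comp, ← CommRingCat.ofHom_comp]
    congr 2
    ext r
    exact Complex.conj_ofReal r)

/-- The morphism `Spec ℂ ⟶ Spec ℝ`. -/
def specIncl : specOver ℂ ⟶ specOver ℝ :=
  Over.homMk (Spec.map (CommRingCat.ofHom (algebraMap ℝ ℂ))) (by
    change Spec.map _ ≫ Spec.map _ = Spec.map _
    rw [← Spec.map_comp, ← CommRingCat.ofHom_comp])

theorem specConj_specConj : specConj ≫ specConj = 𝟙 _ := by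
  ext1
  change Spec.map _ ≫ Spec.map _ = 𝟙 (Spec (.of ℂ))
  rw [← Spec.map_comp, ← CommRingCat.ofHom_comp]
  have : (starRingEnd ℂ).comp (starRingEnd ℂ) = RingHom.id ℂ := by
    ext x; simp
  rw [this]
  exact Spec.map_id _

theorem specConj_specIncl : specConj ≫ specIncl = specIncl := by
  ext1
  change Spec.map _ ≫ Spec.map _ = Spec.map _
  rw [← Spec.map_comp, ← CommRingCat.ofHom_comp]
  congr 2
  ext r
  exact Complex.conj_ofReal r

theorem exists_lift {B C : RSch} (j : B ⟶ C) [Surjective j.left] [LocallyOfFiniteType B.hom] (c : Pt ℂ C) :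
    ∃ b : Pt ℂ B, b ≫ j = c := by
  have hj : LocallyOfFiniteType j.left := by
    have : LocallyOfFiniteType (j.left ≫ C.hom) := by rw [Over.w]; infer_instance
    exact locallyOfFiniteType_of_comp j.left C.hom
  let c' : Spec (.of ℂ) ⟶ C.left := c.left
  let P : Scheme := pullback j.left c'
  let q : P ⟶ Spec (.of ℂ) := pullback.snd j.left c'
  have hq : Surjective q := inferInstance
  have hne : Nonempty P :=
    let ⟨x, _⟩ := q.surjective (IsLocalRing.closedPoint ℂ)
    ⟨x⟩
  have := LocallyOfFiniteType.jacobsonSpace q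
  obtain ⟨x, -, hx⟩ := nonempty_inter_closedPoints (Z := (Set.univ : Set P))
    Set.univ_nonempty isClosed_univ.isLocallyClosed
  let p := pointOfClosedPoint q x hx
  have hp : p ≫ q = 𝟙 _ := pointOfClosedPoint_comp q x hx
  have h1 : (p ≫ pullback.fst j.left c') ≫ j.left = c' := by
    rw [Category.assoc, pullback.condition, ← Category.assoc, hp, Category.id_comp]
  refine ⟨Over.homMk (p ≫ pullback.fst j.left c') ?_, ?_⟩
  · rw [← Over.w j, ← Category.assoc, h1]
    exact Over.w c
  · ext1
    exact h1

section Galois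

variable {A B C : RSch} [GrpObj A] [GrpObj B] [GrpObj C]

/-- The inclusion `G(ℝ) → G(ℂ)`. -/
abbrev toComplex {X : RSch} (x : Pt ℝ X) : Pt ℂ X := specIncl ≫ x

variable (A) in
/-- The action `g ↦ ᵞg` of complex conjugation on `G(ℂ)`. -/
def conj : Pt ℂ A →* Pt ℂ A where
  toFun g := specConj ≫ g
  map_one' := MonObj.comp_one _
  map_mul' g h := MonObj.comp_mul _ g h

theorem conj_conj (a : Pt ℂ A) : conj A (conj A a) = a := by
  change specConj ≫ specConj ≫ a = a
  rw [← Category.assoc, specConj_specConj, Category.id_comp]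

theorem conj_ptHom (i : A ⟶ B) [IsMonHom i] (a : Pt ℂ A) :
    ptHom ℂ i (conj A a) = conj B (ptHom ℂ i a) :=
  Category.assoc specConj a i

theorem conj_toComplex (c : Pt ℝ C) : conj C (toComplex c) = toComplex c := by
  change specConj ≫ specIncl ≫ c = specIncl ≫ c
  rw [← Category.assoc, specConj_specIncl]

variable (A) in
/-- The Galois cohomology set `H¹ A = H¹(Gal(ℂ/ℝ), A(ℂ))`. -/
abbrev galH1 : Type := H1 (conj A)

/-- The map `f_*¹ : H¹ A → H¹ B` induced by a homomorphism `f`. -/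
def galH1Map (f : A ⟶ B) [IsMonHom f] : galH1 A → galH1 B :=
  H1.map (ptHom ℂ f) (conj_ptHom f)

/-- `1 ⟶ A ⟶ B ⟶ C ⟶ 1` is a short exact sequence of group schemes over `ℝ`: the homomorphism `i`
is a kernel of `j`, and `j` is faithfully flat. -/
structure IsShortExact (i : A ⟶ B) (j : B ⟶ C) : Prop where
  kernel : IsPullback i (toUnit A) j η[C]
  flat : Flat j.left
  surjective : Surjective j.left

variable {i : A ⟶ B} {j : B ⟶ C}

/-- `h ∈ H¹ A` arises from `c ∈ C(ℝ)` by lifting `c` to some `b ∈ B(ℂ)` and taking the class of the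
cocycle `a = b⁻¹ · ᵞb` in `A(ℂ) ⊆ B(ℂ)`. -/
def IsConnectingValue (i : A ⟶ B) (j : B ⟶ C) [IsMonHom i] [IsMonHom j] (c : Pt ℝ C)
    (h : galH1 A) : Prop :=
  ∃ (b : Pt ℂ B) (a : Z1 (conj A)),
    ptHom ℂ j b = toComplex c ∧ ptHom ℂ i a.1 = b⁻¹ * conj B b ∧ h = H1.mk a

variable [IsMonHom i]

theorem ptHom_injective (hS : IsShortExact i j) (K : Type) [CommRing K] [Algebra ℝ K] :
    Function.Injective (ptHom K i) := fun _ _ h =>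
  hS.kernel.hom_ext h (toUnit_unique _ _)

variable [IsMonHom j]

theorem exists_preimage (hS : IsShortExact i j) {K : Type} [CommRing K] [Algebra ℝ K]
    {b : Pt K B} (hb : ptHom K j b = 1) : ∃ a : Pt K A, ptHom K i a = b :=
  ⟨hS.kernel.lift b (toUnit _) hb, hS.kernel.lift_fst _ _ _⟩

theorem existsUnique_connecting (hS : IsShortExact i j) [LocallyOfFiniteType B.hom]
    (c : Pt ℝ C) : ∃! h : galH1 A, IsConnectingValue i j c h := by
  have := hS.surjective
  obtain ⟨b, hb⟩ := exists_lift j (toComplex c)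
  replace hb : ptHom ℂ j b = toComplex c := hb
  obtain ⟨a, ha⟩ := exists_preimage hS (b := b⁻¹ * conj B b) (by
    rw [map_mul, map_inv, conj_ptHom, hb, conj_toComplex, inv_mul_cancel])
  have hz : a * conj A a = 1 := by
    apply ptHom_injective hS ℂ
    rw [map_mul, conj_ptHom, ha, map_mul, map_inv, conj_conj, map_one]
    group
  refine ⟨H1.mk ⟨a, hz⟩, ⟨b, ⟨a, hz⟩, hb, ha, rfl⟩, ?_⟩
  rintro _ ⟨b', a', hb', ha', rfl⟩
  obtain ⟨x, hx⟩ := exists_preimage hS (b := b'⁻¹ * b) (by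
    rw [map_mul, map_inv, hb, hb', inv_mul_cancel])
  refine Quotient.sound (s := cohomologous (conj A)) ⟨x⁻¹, ?_⟩
  apply ptHom_injective hS ℂ
  have hxb : b = b' * ptHom ℂ i x := by rw [hx]; group
  change ptHom ℂ i a = ptHom ℂ i (x⁻¹ * a'.1 * (conj A x⁻¹)⁻¹)
  rw [map_mul, map_mul, map_inv, map_inv, map_inv, map_inv, conj_ptHom, ha, ha', hxb, map_mul]
  group

/-- The connecting map `δ : C(ℝ) → H¹ A`, `δ(c) = [b⁻¹ · ᵞb]` for any lift `b ∈ B(ℂ)` of `c`. -/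
def connecting (hS : IsShortExact i j) [LocallyOfFiniteType B.hom] (c : Pt ℝ C) : galH1 A :=
  (existsUnique_connecting hS c).choose

theorem connecting_spec (hS : IsShortExact i j) [LocallyOfFiniteType B.hom] (c : Pt ℝ C)
    (h : galH1 A) : connecting hS c = h ↔ IsConnectingValue i j c h :=
  ⟨fun e => e ▸ (existsUnique_connecting hS c).choose_spec.1,
    fun H => ((existsUnique_connecting hS c).choose_spec.2 h H).symm⟩

end Galois

/-- Exactness of `X → Y → Z` at `Y`, for maps of sets where `Z` has a distinguished element `1`:
the preimage of `1` is the image of the first map. -/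
def ExactAt {X Y Z : Type} [One Z] (f : X → Y) (g : Y → Z) : Prop :=
  ∀ y : Y, g y = 1 ↔ ∃ x : X, f x = y

end RealGrp

end

open RealGrp

namespace RealGrp

open Topology Set Filter

/-! ### Simple roots depending on a parameter -/

/-! The cohomological part is cocycle algebra: complex points of `C` lift to `B` (`exists_lift`),
and complex points fixed by conjugation are real (`exists_toComplex_eq`). Since δ(j(b)c) = δ(c) for
real b, the descent of δ to π₀ and the exactness at π₀B(ℝ) and π₀C(ℝ) come down to one topological
fact, C(ℝ)⁰ ⊆ j(B(ℝ)⁰) (`identityComponent_le_map`). It holds because j is open on real points and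
B(ℝ)⁰ is open: then j(B(ℝ)⁰) is an open subgroup, hence also closed.

Both kinds of openness come from smoothness. A smooth algebra is locally standard étale over a
polynomial ring, and a standard étale map is a local homeomorphism on real points because simple
real roots vary continuously. So smooth morphisms are open on real points
(`isOpenMap_ptMap_of_smooth`), and smooth schemes have connected neighbourhoods of their real
points, which makes the identity component open.

Smoothness itself is obtained on underlying reduced schemes, which have the same real points
(`smooth_reduced_of_surjective`). Over ℂ, a surjective map of reduced schemes is smooth at a
suitable generic point, where it is an extension of fields of characteristic zero. Translations move
any closed point to any other, so it is smooth everywhere (`smooth_of_transitive`), and smoothness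
descends to ℝ. -/

/-- An implicit function theorem with a merely topological parameter. Near a simple zero F is
strictly monotone in t, its signs at both ends of a small interval persist for nearby φ, and the
intermediate value theorem gives the root. -/
theorem exists_unique_root_near {T : Type*} [TopologicalSpace T] {F F' : T × ℝ → ℝ}
    (hF : Continuous F) (hF' : Continuous F')
    (hd : ∀ φ t, HasDerivAt (fun t => F (φ, t)) (F' (φ, t)) t)
    {φ₀ : T} {t₀ : ℝ} (h0 : F (φ₀, t₀) = 0) (h1 : F' (φ₀, t₀) ≠ 0) {N : Set (T × ℝ)}
    (hN : N ∈ 𝓝 (φ₀, t₀)) :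
    ∃ U ∈ 𝓝 φ₀, ∃ V ∈ 𝓝 t₀, U ×ˢ V ⊆ N ∧ ∀ φ ∈ U, ∃! t, t ∈ V ∧ F (φ, t) = 0 := by
  wlog hpos : 0 < F' (φ₀, t₀) generalizing F F'
  · have := this (F := fun x => - F x) (F' := fun x => - F' x) hF.neg hF'.neg
      (fun φ t => (hd φ t).neg) (by simp [h0]) (by simpa using h1)
      (by have := lt_of_le_of_ne (not_lt.1 hpos) h1; linarith)
    simpa using this
  have hmem : {x | 0 < F' x} ∩ N ∈ 𝓝 (φ₀, t₀) :=
    inter_mem ((isOpen_lt continuous_const hF').mem_nhds hpos) hN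
  obtain ⟨U₁, hU₁, V₁, hV₁, hUV⟩ := mem_nhds_prod_iff.1 hmem
  obtain ⟨ε, hε, hεV⟩ := Metric.nhds_basis_closedBall.mem_iff.1 hV₁
  rw [Real.closedBall_eq_Icc] at hεV
  have hmono : ∀ φ ∈ U₁, StrictMonoOn (fun t => F (φ, t)) (Icc (t₀ - ε) (t₀ + ε)) := by
    intro φ hφ
    refine strictMonoOn_of_deriv_pos (convex_Icc _ _) (by fun_prop) fun t ht => ?_
    rw [interior_Icc] at ht
    rw [(hd φ t).deriv]
    exact (hUV (mk_mem_prod hφ (hεV (Ioo_subset_Icc_self ht)))).1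
  have h00 := mem_of_mem_nhds hU₁
  have hl : F (φ₀, t₀ - ε) < 0 := by
    have := hmono φ₀ h00 (a := t₀ - ε) (b := t₀) ⟨le_rfl, by linarith⟩ ⟨by linarith, by linarith⟩
      (by linarith)
    simpa [h0] using this
  have hr : 0 < F (φ₀, t₀ + ε) := by
    have := hmono φ₀ h00 (a := t₀) (b := t₀ + ε) ⟨by linarith, by linarith⟩ ⟨by linarith, le_rfl⟩
      (by linarith)
    simpa [h0] using this
  have hl' : ∀ᶠ φ in 𝓝 φ₀, F (φ, t₀ - ε) < 0 :=
    (show Continuous fun φ => F (φ, t₀ - ε) by fun_prop).continuousAt.eventually_lt_const hl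
  have hr' : ∀ᶠ φ in 𝓝 φ₀, 0 < F (φ, t₀ + ε) :=
    (show Continuous fun φ => F (φ, t₀ + ε) by fun_prop).continuousAt.eventually_const_lt hr
  refine ⟨{φ | φ ∈ U₁ ∧ F (φ, t₀ - ε) < 0 ∧ 0 < F (φ, t₀ + ε)},
    (Filter.eventually_mem_set.2 hU₁).and (hl'.and hr'), Icc (t₀ - ε) (t₀ + ε),
    Icc_mem_nhds (by linarith) (by linarith), ?_, ?_⟩
  · rintro ⟨φ, t⟩ ⟨hφ, ht⟩
    exact (hUV (mk_mem_prod hφ.1 (hεV ht))).2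
  · rintro φ ⟨hφ, ha, hb⟩
    obtain ⟨t, ht, hFt⟩ := intermediate_value_Icc (by linarith : t₀ - ε ≤ t₀ + ε)
      (show ContinuousOn (fun t => F (φ, t)) _ by fun_prop) (show (0:ℝ) ∈ _ from ⟨ha.le, hb.le⟩)
    exact ⟨t, ⟨ht, hFt⟩, fun s hs => (hmono φ hφ).injOn hs.1 ht (hs.2.trans hFt.symm)⟩

/-! ### Real points of rings -/

/-- The set of ring homomorphisms `R → ℝ`, with the topology of pointwise convergence. -/
def RPt (R : Type*) [CommRing R] : Type _ := R →+* ℝ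

namespace RPt

variable {R S : Type*} [CommRing R] [CommRing S]

/-- A real point as a ring homomorphism. -/
def toHom (φ : RPt R) : R →+* ℝ := φ

/-- Evaluation of a function at a real point. -/
def ev (φ : RPt R) (r : R) : ℝ := toHom φ r

instance : TopologicalSpace (RPt R) := TopologicalSpace.induced ev inferInstance

theorem continuous_ev (r : R) : Continuous fun φ : RPt R => ev φ r :=
  (continuous_apply (A := fun _ : R => ℝ) r).comp continuous_induced_dom

theorem continuous_iff {T : Type*} [TopologicalSpace T] {f : T → RPt R} :
    Continuous f ↔ ∀ r, Continuous fun t => ev (f t) r :=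
  continuous_induced_rng.trans continuous_pi_iff

/-- Restriction of real points along a ring homomorphism. -/
def comap (f : R →+* S) (ψ : RPt S) : RPt R := (toHom ψ).comp f

@[simp] theorem ev_comap (f : R →+* S) (ψ : RPt S) (r : R) : ev (comap f ψ) r = ev ψ (f r) := rfl

theorem continuous_comap (f : R →+* S) : Continuous (comap f) :=
  continuous_iff.2 fun r => continuous_ev (f r)

@[ext] theorem ext {φ ψ : RPt R} (h : ∀ r, ev φ r = ev ψ r) : φ = ψ :=
  RingHom.ext (f := toHom φ) (g := toHom ψ) h

theorem ev_mul (φ : RPt R) (a b : R) : ev φ (a * b) = ev φ a * ev φ b := (toHom φ).map_mul a b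
theorem ev_pow (φ : RPt R) (a : R) (n : ℕ) : ev φ (a ^ n) = ev φ a ^ n := (toHom φ).map_pow a n
theorem ev_ne_zero_of_isUnit (φ : RPt R) {a : R} (h : IsUnit a) : ev φ a ≠ 0 :=
  (h.map (toHom φ)).ne_zero

/-- Every element of `S` is a fraction a/fⁿ, so its values depend continuously on those of a and f.
The image is the locus f ≠ 0. -/
theorem isOpenEmbedding_comap_away [Algebra R S] (f : R) [IsLocalization.Away f S] :
    IsOpenEmbedding (comap (algebraMap R S)) := by
  have hu : ∀ ψ : RPt S, ev ψ (algebraMap R S f) ≠ 0 := fun ψ =>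
    ev_ne_zero_of_isUnit ψ (IsLocalization.Away.algebraMap_isUnit f)
  have hs : ∀ s : S, ∃ (a : R) (n : ℕ), ∀ ψ : RPt S,
      ev ψ s = ev (comap (algebraMap R S) ψ) a / ev (comap (algebraMap R S) ψ) f ^ n := by
    intro s
    obtain ⟨n, a, h⟩ := IsLocalization.Away.surj f s
    refine ⟨a, n, fun ψ => ?_⟩
    rw [ev_comap, ev_comap, eq_div_iff (pow_ne_zero _ (hu ψ)), ← h, ev_mul, ev_pow]
  have hrange : range (comap (algebraMap R S)) = {φ | ev φ f ≠ 0} := by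
    ext φ
    constructor
    · rintro ⟨ψ, rfl⟩
      exact hu ψ
    · intro h
      exact ⟨IsLocalization.Away.lift (g := (toHom φ)) f (isUnit_iff_ne_zero.2 h),
        IsLocalization.Away.lift_comp ..⟩
  refine ⟨⟨⟨le_antisymm (continuous_comap _).le_induced ?_⟩, ?_⟩, ?_⟩
  -- Comparing the topologies means that each evaluation is continuous for the induced one.
  · rw [← continuous_id_iff_le, @continuous_iff _ _ _ (_)]
    intro s
    obtain ⟨a, n, h⟩ := hs s
    simp only [id, h]
    let _ : TopologicalSpace (RPt S) :=
      TopologicalSpace.induced (comap (algebraMap R S)) inferInstance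
    have hc : Continuous (comap (algebraMap R S)) := continuous_induced_dom
    exact ((continuous_ev a).comp hc).div (((continuous_ev f).comp hc).pow n)
      fun ψ => pow_ne_zero _ (hu ψ)
  · intro ψ ψ' h
    ext s
    obtain ⟨a, n, hs⟩ := hs s
    rw [hs, hs, h]
  · rw [hrange]
    exact isOpen_ne_fun (continuous_ev f) continuous_const

/-- Real points of a polynomial ring. -/
noncomputable def mvPolynomialEquiv (n : ℕ) : RPt (MvPolynomial (Fin n) R) ≃ₜ RPt R × (Fin n → ℝ) where
  toFun ψ := (comap MvPolynomial.C ψ, fun i => ev ψ (.X i))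
  invFun x := MvPolynomial.eval₂Hom (toHom x.1) x.2
  left_inv ψ := by
    refine MvPolynomial.ringHom_ext (fun r => ?_) fun i => ?_
    · exact MvPolynomial.eval₂Hom_C ..
    · exact MvPolynomial.eval₂Hom_X' ..
  right_inv x := by
    refine Prod.ext (RingHom.ext fun r => ?_) (funext fun i => ?_)
    · exact MvPolynomial.eval₂Hom_C ..
    · exact MvPolynomial.eval₂Hom_X' ..
  continuous_toFun := (continuous_comap _).prodMk (continuous_pi fun i => continuous_ev _)
  continuous_invFun := by
    refine continuous_iff.2 fun p => ?_
    change Continuous fun x : RPt R × (Fin n → ℝ) =>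
      MvPolynomial.eval₂ (toHom x.1) x.2 p
    simp only [MvPolynomial.eval₂_eq]
    refine continuous_finsetSum _ fun m _ => ((continuous_ev _).comp continuous_fst).mul ?_
    exact continuous_finsetProd _ fun i _ => ((continuous_apply i).comp continuous_snd).pow _

theorem isOpenMap_comap_mvPolynomial (n : ℕ) :
    IsOpenMap (comap (algebraMap R (MvPolynomial (Fin n) R))) :=
  isOpenMap_fst.comp (mvPolynomialEquiv n).isOpenMap

/-- The value of a polynomial with coefficients in `R` at a point of `RPt R × ℝ`. -/
noncomputable def peval (p : Polynomial R) (x : RPt R × ℝ) : ℝ := p.eval₂ (toHom x.1) x.2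

theorem continuous_peval (p : Polynomial R) : Continuous (peval p) := by
  unfold peval
  simp only [Polynomial.eval₂_eq_sum_range]
  exact continuous_finsetSum _ fun m _ =>
    ((continuous_ev _).comp continuous_fst).mul (continuous_snd.pow _)

theorem hasDerivAt_peval (p : Polynomial R) (φ : RPt R) (t : ℝ) :
    HasDerivAt (fun t => peval p (φ, t)) (peval p.derivative (φ, t)) t := by
  have := (p.map (toHom φ)).hasDerivAt t
  simpa [peval, Polynomial.eval_map, Polynomial.derivative_map] using this

/-! ### Standard étale algebras -/

section Etale

variable [Algebra R S] (P : StandardEtalePresentation R S)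

theorem ev_aeval (p : Polynomial R) (ψ : RPt S) (s : S) :
    ev ψ (p.aeval s) = peval p (comap (algebraMap R S) ψ, ev ψ s) := by
  rw [Polynomial.aeval_def]
  exact Polynomial.hom_eval₂ p (algebraMap R S) (toHom ψ) s

/-- The embedding of the real points of a standard étale algebra into `RPt R × ℝ`. -/
def etaleMap (ψ : RPt S) : RPt R × ℝ := (comap (algebraMap R S) ψ, ev ψ P.x)

theorem isEmbedding_etaleMap : IsEmbedding (etaleMap P) := by
  have hc : Continuous (etaleMap P) := (continuous_comap _).prodMk (continuous_ev _)
  have hu : ∀ ψ : RPt S, peval P.g (etaleMap P ψ) ≠ 0 := fun ψ => by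
    rw [etaleMap, ← ev_aeval]
    exact ev_ne_zero_of_isUnit ψ P.hasMap.2
  have hs : ∀ s : S, ∃ (p : Polynomial R) (n : ℕ), ∀ ψ : RPt S,
      ev ψ s = peval p (etaleMap P ψ) / peval P.g (etaleMap P ψ) ^ n := by
    intro s
    obtain ⟨p, n, h⟩ := P.exists_mul_aeval_x_g_pow_eq_aeval_x s
    refine ⟨p, n, fun ψ => ?_⟩
    rw [eq_div_iff (pow_ne_zero _ (hu ψ)), etaleMap, ← ev_aeval, ← ev_aeval, ← h, ev_mul, ev_pow]
  refine ⟨⟨le_antisymm hc.le_induced ?_⟩, ?_⟩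
  · rw [← continuous_id_iff_le, @continuous_iff _ _ _ (_)]
    intro s
    obtain ⟨p, n, h⟩ := hs s
    simp only [id, h]
    let _ : TopologicalSpace (RPt S) := TopologicalSpace.induced (etaleMap P) inferInstance
    have hc : Continuous (etaleMap P) := continuous_induced_dom
    exact ((continuous_peval p).comp hc).div (((continuous_peval P.g).comp hc).pow n)
      fun ψ => pow_ne_zero _ (hu ψ)
  · intro ψ ψ' h
    ext s
    obtain ⟨p, n, hs⟩ := hs s
    rw [hs, hs, h]

/-- The universal property of R[X]_g/(f), with ℝ made an `R`-algebra through the base point. -/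
theorem exists_etaleMap_eq {x : RPt R × ℝ} (hf : peval P.f x = 0) (hg : peval P.g x ≠ 0) :
    ∃ ψ, etaleMap P ψ = x := by
  let _ : Algebra R ℝ := RingHom.toAlgebra (toHom x.1)
  have hm : P.P.HasMap x.2 := ⟨hf, isUnit_iff_ne_zero.2 hg⟩
  let θ : S →ₐ[R] ℝ := (P.P.lift x.2 hm).comp P.equivRing.toAlgHom
  refine ⟨θ.toRingHom, Prod.ext (RingHom.ext fun r => θ.commutes r) ?_⟩
  change P.P.lift x.2 hm (P.equivRing P.x) = x.2
  rw [P.equivRing_x, StandardEtalePair.lift_X]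

/-- The derivative of `P.f` is a unit at `P.x`, so real points over φ are simple roots, and
`exists_unique_root_near` applies. -/
theorem isLocalHomeomorph_comap_of_isStandardEtale [Algebra.IsStandardEtale R S] :
    IsLocalHomeomorph (comap (algebraMap R S)) := by
  have P : StandardEtalePresentation R S := Nonempty.some inferInstance
  have hP := isEmbedding_etaleMap P
  have hroot : ∀ ψ, peval P.f (etaleMap P ψ) = 0 := fun ψ => by
    rw [etaleMap, ← ev_aeval, P.hasMap.1]
    exact (toHom ψ).map_zero
  -- Existence in this statement will give openness; uniqueness will give local injectivity.
  have key : ∀ ψ₀ : RPt S, ∀ N ∈ 𝓝 ψ₀, ∃ U ∈ 𝓝 (comap (algebraMap R S) ψ₀), ∃ V ∈ 𝓝 (ev ψ₀ P.x),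
      etaleMap P ⁻¹' (U ×ˢ V) ⊆ N ∧ ∀ φ ∈ U, ∃! ψ, ev ψ P.x ∈ V ∧ comap (algebraMap R S) ψ = φ := by
    intro ψ₀ N hN
    rw [hP.nhds_eq_comap, mem_comap] at hN
    obtain ⟨M, hM, hMN⟩ := hN
    have hg : peval P.g (etaleMap P ψ₀) ≠ 0 := by
      rw [etaleMap, ← ev_aeval]
      exact ev_ne_zero_of_isUnit ψ₀ P.hasMap.2
    have hd : peval P.f.derivative (etaleMap P ψ₀) ≠ 0 := by
      rw [etaleMap, ← ev_aeval]
      exact ev_ne_zero_of_isUnit ψ₀ P.hasMap.isUnit_derivative_f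
    obtain ⟨U, hU, V, hV, hUV, h⟩ := exists_unique_root_near (continuous_peval P.f)
      (continuous_peval P.f.derivative) (hasDerivAt_peval P.f) (hroot ψ₀) hd
      (inter_mem hM ((isOpen_ne_fun (continuous_peval P.g) continuous_const).mem_nhds hg))
    refine ⟨U, hU, V, hV, fun ψ hψ => hMN (hUV hψ).1, fun φ hφ => ?_⟩
    obtain ⟨t, ⟨htV, ht⟩, huniq⟩ := h φ hφ
    obtain ⟨ψ, hψ⟩ := exists_etaleMap_eq P ht (hUV (mk_mem_prod hφ htV)).2
    have h1 : comap (algebraMap R S) ψ = φ := congr_arg Prod.fst hψ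
    have h2 : ev ψ P.x = t := congr_arg Prod.snd hψ
    refine ⟨ψ, ⟨h2 ▸ htV, h1⟩, fun ψ' hψ' => hP.injective (Prod.ext (hψ'.2.trans h1.symm) ?_)⟩
    refine (huniq _ ⟨hψ'.1, ?_⟩).trans h2.symm
    rw [← hψ'.2]
    exact hroot ψ'
  have hopen : IsOpenMap (comap (algebraMap R S)) := by
    refine isOpenMap_iff_nhds_le.2 fun ψ₀ N hN => ?_
    obtain ⟨U, hU, V, -, hUV, h⟩ := key ψ₀ _ hN
    filter_upwards [hU] with φ hφ
    obtain ⟨ψ, ⟨hψ, rfl⟩, -⟩ := h φ hφ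
    exact hUV (mk_mem_prod hφ hψ)
  refine isLocalHomeomorph_iff_isOpenEmbedding_restrict.2 fun ψ₀ => ?_
  obtain ⟨U, hU, V, hV, -, h⟩ := key ψ₀ _ univ_mem
  obtain ⟨W, hW, hWo, hWm⟩ := _root_.mem_nhds_iff.1
    (hP.continuous.continuousAt.preimage_mem_nhds (prod_mem_nhds hU hV) : _ ∈ 𝓝 ψ₀)
  refine ⟨W, hWo.mem_nhds hWm, .of_continuous_injective_isOpenMap
    ((continuous_comap _).comp continuous_subtype_val) ?_ (hopen.domRestrict hWo)⟩
  rintro ⟨ψ, hψ⟩ ⟨ψ', hψ'⟩ e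
  have e : comap (algebraMap R S) ψ = comap (algebraMap R S) ψ' := e
  exact Subtype.ext ((h _ (hW hψ).1).unique ⟨(hW hψ).2, rfl⟩ ⟨(hW hψ').2, e.symm⟩)

end Etale

/-! ### Smooth algebras -/

section Smooth

variable [Algebra R S] [Algebra.Smooth R S]

/-- Local structure of smooth algebras at the prime ker ψ₀. As f lies outside this prime, ψ₀ extends
to the localization. -/
theorem exists_etale_chart (ψ₀ : RPt S) : ∃ (n : ℕ) (f : S) (e : MvPolynomial (Fin n) R →+*
    Localization.Away f), IsLocalHomeomorph (comap e) ∧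
    e.comp (algebraMap R _) = (algebraMap S (Localization.Away f)).comp (algebraMap R S) ∧
    ψ₀ ∈ range (comap (algebraMap S (Localization.Away f))) := by
  let p : Ideal S := RingHom.ker (toHom ψ₀)
  have : p.IsPrime := RingHom.ker_isPrime _
  have : Algebra.IsSmoothAt R p := inferInstance
  obtain ⟨f, hf, n, _, h1, h2⟩ := Algebra.IsSmoothAt.exists_isStandardEtale_mvPolynomial
    (R := R) (p := p)
  refine ⟨n, f, algebraMap _ _, isLocalHomeomorph_comap_of_isStandardEtale, ?_, ?_⟩
  · rw [← IsScalarTower.algebraMap_eq, ← IsScalarTower.algebraMap_eq]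
  · exact ⟨IsLocalization.Away.lift (g := (toHom ψ₀)) f (isUnit_iff_ne_zero.2 hf),
        IsLocalization.Away.lift_comp ..⟩

theorem isOpenMap_comap_of_smooth : IsOpenMap (comap (algebraMap R S)) := by
  refine isOpenMap_iff_nhds_le.2 fun ψ₀ => ?_
  obtain ⟨n, f, e, he, hc, ψ, rfl⟩ := exists_etale_chart (R := R) ψ₀
  have ho := (isOpenEmbedding_comap_away (S := Localization.Away f) f)
  rw [← ho.map_nhds_eq, Filter.map_map]
  have h : comap (algebraMap R S) ∘ comap (algebraMap S (Localization.Away f)) =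
      comap (algebraMap R (MvPolynomial (Fin n) R)) ∘ comap e := by
    funext ψ
    exact congr_arg (toHom ψ).comp hc.symm
  rw [h, show comap (algebraMap R S) (comap (algebraMap S (Localization.Away f)) ψ) =
    comap (algebraMap R (MvPolynomial (Fin n) R)) (comap e ψ) from congr_fun h ψ]
  exact ((isOpenMap_comap_mvPolynomial n).comp he.isOpenMap).nhds_le ψ

/-- With a single real point below, real points of the polynomial ring form ℝⁿ, and the étale chart
carries a small ball back to a connected neighbourhood. -/
theorem exists_isConnected_nhds_of_smooth [Subsingleton (RPt R)] (ψ₀ : RPt S) :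
    ∃ N ∈ 𝓝 ψ₀, _root_.IsConnected N := by
  obtain ⟨n, f, e, he, hc, ψ, rfl⟩ := exists_etale_chart (R := R) ψ₀
  obtain ⟨c, hψ, hce⟩ := he ψ
  have ho := (isOpenEmbedding_comap_away (S := Localization.Away f) f)
  let x := mvPolynomialEquiv n (c ψ)
  let k : (Fin n → ℝ) → RPt (MvPolynomial (Fin n) R) := fun t => (mvPolynomialEquiv n).symm (x.1, t)
  have hk : Continuous k := by fun_prop
  have hks : k x.2 = c ψ := (mvPolynomialEquiv n).symm_apply_apply _
  have hkinj : ∀ y, k (mvPolynomialEquiv n y).2 = y := fun y => by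
    have : (x.1, (mvPolynomialEquiv n y).2) = mvPolynomialEquiv n y :=
      Prod.ext (Subsingleton.elim _ _) rfl
    simp only [k, this, Homeomorph.symm_apply_apply]
  have hko : k ⁻¹' c.target ∈ 𝓝 x.2 :=
    (c.open_target.preimage hk).mem_nhds (by
      rw [mem_preimage, hks]; exact c.map_source hψ)
  obtain ⟨ε, hε, hball⟩ := Metric.mem_nhds_iff.1 hko
  have hconn : _root_.IsConnected (Metric.ball x.2 ε) :=
    (convex_ball x.2 ε).isConnected (Metric.nonempty_ball.2 hε)
  have hcont : ContinuousOn (c.symm ∘ k) (Metric.ball x.2 ε) :=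
    c.continuousOn_symm.comp hk.continuousOn hball
  refine ⟨_, ?_, (hconn.image _ hcont).image _ ho.continuous.continuousOn⟩
  refine ho.image_mem_nhds.2 ?_
  have hpre : c.source ∩ c ⁻¹' ((fun y => (mvPolynomialEquiv n y).2) ⁻¹' Metric.ball x.2 ε) ∈
      𝓝 ψ := by
    refine (c.isOpen_inter_preimage (Metric.isOpen_ball.preimage
      (continuous_snd.comp (mvPolynomialEquiv n).continuous))).mem_nhds
      ⟨hψ, Metric.mem_ball_self hε⟩
  refine mem_of_superset hpre ?_
  rintro y ⟨hy, hyb⟩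
  refine ⟨_, hyb, ?_⟩
  simp only [Function.comp_apply, hkinj]
  exact c.left_inv hy

end Smooth

end RPt

end RealGrp

namespace RealGrp

open Topology Set Filter Opposite

/-! ### Affine charts for the real topology -/

/-- The identity is the only ring endomorphism of ℝ. Hence morphisms from Spec ℝ are automatically
over ℝ, and plain ring homomorphisms suffice in `RPt`. -/
theorem specReal_hom_ext (f g : Spec (.of ℝ) ⟶ Spec (.of ℝ)) : f = g := by
  obtain ⟨f, rfl⟩ := Spec.map_surjective f
  obtain ⟨g, rfl⟩ := Spec.map_surjective g
  congr 1
  ext1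
  exact Subsingleton.elim _ _

variable {X Y : RSch}

/-- The real point of `X` given by a real point of the ring of functions on an affine open. -/
noncomputable def chart {U : X.left.Opens} (hU : IsAffineOpen U) (φ : RPt Γ(X.left, U)) : Pt ℝ X :=
  Over.homMk (Spec.map (CommRingCat.ofHom φ.toHom) ≫ hU.fromSpec) (specReal_hom_ext _ _)

/-- Evaluation of functions on `U` at a real point in `U`. -/
noncomputable def evalPt (x : Pt ℝ X) {U : X.left.Opens} (h : ⊤ ≤ x.left ⁻¹ᵁ U) : RPt Γ(X.left, U) :=
  (x.left.appLE U ⊤ h ≫ (Scheme.ΓSpecIso (.of ℝ)).hom).hom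

theorem top_le_preimage_iff' {Z : Scheme} {x : Spec (.of ℝ) ⟶ Z} {U : Z.Opens} :
    ⊤ ≤ x ⁻¹ᵁ U ↔ x (IsLocalRing.closedPoint ℝ) ∈ U := by
  refine ⟨fun h => h (mem_univ _), fun h p _ => ?_⟩
  rwa [Subsingleton.elim p (IsLocalRing.closedPoint ℝ)]

theorem specMap_appLE_comp_fromSpec {Z : Scheme} {K : CommRingCat} (x : Spec K ⟶ Z) {U : Z.Opens}
    (hU : IsAffineOpen U) (h : ⊤ ≤ x ⁻¹ᵁ U) :
    Spec.map (x.appLE U ⊤ h ≫ (Scheme.ΓSpecIso K).hom) ≫ hU.fromSpec = x := by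
  rw [Spec.map_comp, Category.assoc, IsAffineOpen.SpecMap_appLE_fromSpec _ hU (isAffineOpen_top _),
    IsAffineOpen.fromSpec_top, ← Category.assoc]
  have : Spec.map (Scheme.ΓSpecIso K).hom ≫ (Spec K).isoSpec.inv = 𝟙 _ := by
    rw [Iso.comp_inv_eq, Category.id_comp]
    simp [Scheme.isoSpec]
  rw [this, Category.id_comp]

theorem appLE_specMap_fromSpec {Z : Scheme} {K : CommRingCat} {U V : Z.Opens}
    (hU : IsAffineOpen U) (hUV : U ≤ V) (φ : Γ(Z, U) ⟶ K)
    (h : ⊤ ≤ (Spec.map φ ≫ hU.fromSpec) ⁻¹ᵁ U) :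
    (Spec.map φ ≫ hU.fromSpec).appLE V ⊤ (h.trans (Scheme.Hom.preimage_mono _ hUV)) ≫
      (Scheme.ΓSpecIso K).hom = Z.presheaf.map (homOfLE hUV).op ≫ φ := by
  rw [← Scheme.Hom.map_appLE (Spec.map φ ≫ hU.fromSpec) h (homOfLE hUV).op, Category.assoc]
  congr 1
  rw [Scheme.Hom.comp_appLE, hU.fromSpec_app_self, Category.assoc, Category.assoc]
  have h1 : (Spec Γ(Z, U)).presheaf.map (eqToHom hU.fromSpec_preimage_self).op ≫
      (Spec.map φ).appLE (hU.fromSpec ⁻¹ᵁ U) ⊤ h = (Spec.map φ).appTop :=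
    (Scheme.Hom.map_appLE _ _ _).trans (Scheme.Hom.appLE_eq_app _)
  rw [reassoc_of% h1, Scheme.ΓSpecIso_naturality, Iso.inv_hom_id_assoc]

theorem top_le_preimage_iff {x : Pt ℝ X} {U : X.left.Opens} :
    ⊤ ≤ x.left ⁻¹ᵁ U ↔ x.left (IsLocalRing.closedPoint ℝ) ∈ U :=
  top_le_preimage_iff'

theorem chart_evalPt (x : Pt ℝ X) {U : X.left.Opens} (hU : IsAffineOpen U)
    (h : ⊤ ≤ x.left ⁻¹ᵁ U) : chart hU (evalPt x h) = x := by
  ext1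
  exact specMap_appLE_comp_fromSpec x.left hU h

theorem top_le_chart {U : X.left.Opens} (hU : IsAffineOpen U) (φ : RPt Γ(X.left, U)) :
    ⊤ ≤ (chart hU φ).left ⁻¹ᵁ U := by
  intro p _
  change hU.fromSpec (Spec.map (CommRingCat.ofHom φ.toHom) p) ∈ U
  have := mem_range_self (f := hU.fromSpec) (Spec.map (CommRingCat.ofHom φ.toHom) p)
  rwa [hU.range_fromSpec] at this

theorem evalPt_chart {U V : X.left.Opens} (hU : IsAffineOpen U) (hUV : U ≤ V)
    (φ : RPt Γ(X.left, U)) (h : ⊤ ≤ (chart hU φ).left ⁻¹ᵁ V) :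
    evalPt (chart hU φ) h = RPt.comap (X.left.presheaf.map (homOfLE hUV).op).hom φ := by
  exact congr_arg CommRingCat.Hom.hom
    (appLE_specMap_fromSpec hU hUV (CommRingCat.ofHom φ.toHom) (top_le_chart hU φ))

theorem mem_basicSet_iff {x : Pt ℝ X} {U : X.left.Opens} {s : Γ(X.left, U)} {W : Set ℝ} :
    x ∈ basicSet U s W ↔ ∃ h : ⊤ ≤ x.left ⁻¹ᵁ U, (evalPt x h).ev s ∈ W := Iff.rfl

theorem isOpen_basicSet (U : X.left.Opens) (s : Γ(X.left, U)) {W : Set ℝ} (hW : IsOpen W) :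
    IsOpen (basicSet U s W) :=
  TopologicalSpace.isOpen_generateFrom_of_mem ⟨U, s, W, hW, rfl⟩

theorem mem_basicSet_of_le {x : Pt ℝ X} {U V : X.left.Opens} (hUV : U ≤ V) {s : Γ(X.left, V)}
    {W : Set ℝ} (hx : ⊤ ≤ x.left ⁻¹ᵁ U) :
    x ∈ basicSet U (X.left.presheaf.map (homOfLE hUV).op s) W ↔ x ∈ basicSet V s W := by
  have h : ∀ h h', (evalPt x (U := U) h).ev (X.left.presheaf.map (homOfLE hUV).op s) =
      (evalPt x (U := V) h').ev s := fun h h' => by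
    have := Scheme.Hom.map_appLE x.left hx (homOfLE hUV).op
    exact congr((Scheme.ΓSpecIso (.of ℝ)).hom.hom ($(this).hom s))
  rw [mem_basicSet_iff, mem_basicSet_iff, exists_prop_of_true hx,
    exists_prop_of_true (hx.trans (x.left.preimage_mono hUV)), h]

/-- The topology tests functions on arbitrary opens `V`. Near a given point one passes to a basic
open of `U` inside `V`, whose real points are open in those of `U` by
`RPt.isOpenEmbedding_comap_away`. -/
theorem continuous_chart {U : X.left.Opens} (hU : IsAffineOpen U) : Continuous (chart hU) := by
  refine continuous_generateFrom_iff.2 ?_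
  rintro _ ⟨V, s, W, hW, rfl⟩
  refine isOpen_iff_mem_nhds.2 fun φ₀ hφ₀ => ?_
  have hx : ⊤ ≤ (chart hU φ₀).left ⁻¹ᵁ V := hφ₀.1
  obtain ⟨g, hgV, hg⟩ := hU.exists_basicOpen_le ⟨_, top_le_preimage_iff.1 hx⟩
    (top_le_preimage_iff.1 (top_le_chart hU φ₀))
  have hD := hU.basicOpen g
  have hloc := hU.isLocalization_basicOpen g
  let ρ : Γ(X.left, U) →+* Γ(X.left, X.left.basicOpen g) :=
    (X.left.presheaf.map (homOfLE (X.left.basicOpen_le g)).op).hom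
  have hρ : ∀ φ, chart hU (RPt.comap ρ φ) = chart hD φ := fun φ => by
    ext1
    change Spec.map (X.left.presheaf.map _ ≫ CommRingCat.ofHom φ.toHom) ≫ _ = _
    rw [Spec.map_comp, Category.assoc, hU.map_fromSpec hD]
    rfl
  have ho : IsOpenEmbedding (RPt.comap ρ) := RPt.isOpenEmbedding_comap_away g
  obtain ⟨φ₁, rfl⟩ : ∃ φ₁, RPt.comap ρ φ₁ = φ₀ := by
    refine ⟨evalPt (chart hU φ₀) (top_le_preimage_iff.2 hg), ?_⟩
    have h1 := congr_arg (fun x : Pt ℝ X => x) (chart_evalPt _ hD (top_le_preimage_iff.2 hg))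
    rw [← hρ] at h1
    have h2 := evalPt_chart hU le_rfl (RPt.comap ρ (evalPt (chart hU φ₀) (top_le_preimage_iff.2 hg)))
      (top_le_chart hU _)
    have h3 := evalPt_chart hU le_rfl φ₀ (top_le_chart hU _)
    have hid : (X.left.presheaf.map (homOfLE (le_refl U)).op).hom = RingHom.id _ :=
      congr_arg CommRingCat.Hom.hom (X.left.presheaf.map_id _)
    rw [hid] at h2 h3
    refine h2.symm.trans (Eq.trans ?_ h3)
    congr 1
  rw [← ho.map_nhds_eq, mem_map, ← preimage_comp]
  have he : chart hU ∘ RPt.comap ρ ⁻¹' basicSet V s W =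
      {φ | RPt.ev φ (X.left.presheaf.map (homOfLE hgV).op s) ∈ W} := by
    ext φ
    rw [mem_preimage, Function.comp_apply, hρ, mem_basicSet_iff]
    have h : ⊤ ≤ (chart hD φ).left ⁻¹ᵁ V :=
      (top_le_chart hD φ).trans ((chart hD φ).left.preimage_mono hgV)
    rw [exists_prop_of_true h, evalPt_chart hD hgV]
    rfl
  rw [he]
  refine (hW.preimage (RPt.continuous_ev _)).mem_nhds ?_
  have : φ₁ ∈ chart hU ∘ RPt.comap ρ ⁻¹' basicSet V s W := hφ₀
  rwa [he] at this

/-- Evaluation is a continuous inverse of the chart on the open set of real points lying in `U`. -/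
theorem isOpenMap_chart {U : X.left.Opens} (hU : IsAffineOpen U) : IsOpenMap (chart hU) := by
  let U' : Set (Pt ℝ X) := {x | ⊤ ≤ x.left ⁻¹ᵁ U}
  have hU' : IsOpen U' := by
    convert isOpen_basicSet U 1 isOpen_univ using 1
    ext x
    simp [U', mem_basicSet_iff]
  let r : U' → RPt Γ(X.left, U) := fun x => evalPt x.1 x.2
  have hr : Continuous r := by
    refine RPt.continuous_iff.2 fun s => continuous_def.2 fun W hW => ?_
    refine ⟨basicSet U s W, isOpen_basicSet U s hW, ?_⟩
    ext x
    have hx : ⊤ ≤ x.1.left ⁻¹ᵁ U := x.2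
    rw [mem_preimage, mem_basicSet_iff, exists_prop_of_true hx]
    rfl
  intro O hO
  have : chart hU '' O = Subtype.val '' (r ⁻¹' O) := by
    ext x
    constructor
    · rintro ⟨φ, hφ, rfl⟩
      refine ⟨⟨chart hU φ, top_le_chart hU φ⟩, ?_, rfl⟩
      have : r ⟨chart hU φ, top_le_chart hU φ⟩ = φ := by
        refine (evalPt_chart hU le_rfl φ _).trans ?_
        have hid : (X.left.presheaf.map (homOfLE (le_refl U)).op).hom = RingHom.id _ :=
          congr_arg CommRingCat.Hom.hom (X.left.presheaf.map_id _)
        rw [hid]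
        rfl
      rwa [mem_preimage, this]
    · rintro ⟨x, hx, rfl⟩
      exact ⟨_, hx, chart_evalPt _ _ _⟩
  rw [this]
  exact hU'.isOpenMap_subtype_val _ (hO.preimage hr)

theorem exists_affine_nhds (x : Pt ℝ X) {V : X.left.Opens} (hV : ⊤ ≤ x.left ⁻¹ᵁ V) :
    ∃ (U : X.left.Opens) (_ : IsAffineOpen U), U ≤ V ∧ ⊤ ≤ x.left ⁻¹ᵁ U := by
  obtain ⟨_, ⟨U, hU, rfl⟩, hxU, hUV⟩ :=
    X.left.isBasis_affineOpens.exists_subset_of_mem_open (top_le_preimage_iff.1 hV) V.2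
  exact ⟨U, hU, hUV, top_le_preimage_iff.2 hxU⟩

theorem ptMap_chart (f : X ⟶ Y) {U : Y.left.Opens} (hU : IsAffineOpen U) {V : X.left.Opens}
    (hV : IsAffineOpen V) (e : V ≤ f.left ⁻¹ᵁ U) (ψ : RPt Γ(X.left, V)) :
    ptMap ℝ f (chart hV ψ) = chart hU (RPt.comap (f.left.appLE U V e).hom ψ) := by
  ext1
  change (Spec.map (CommRingCat.ofHom ψ.toHom) ≫ hV.fromSpec) ≫ f.left =
    Spec.map (f.left.appLE U V e ≫ CommRingCat.ofHom ψ.toHom) ≫ hU.fromSpec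
  rw [Spec.map_comp, Category.assoc, Category.assoc, IsAffineOpen.SpecMap_appLE_fromSpec]

/-- A smooth morphism induces an open map on real points. -/
theorem isOpenMap_ptMap_of_smooth (f : X ⟶ Y) [Smooth f.left] : IsOpenMap (ptMap ℝ f) := by
  refine isOpenMap_iff_nhds_le.2 fun x N hN => ?_
  obtain ⟨U, hU, -, hxU⟩ := exists_affine_nhds (ptMap ℝ f x) (V := ⊤) le_top
  obtain ⟨V, hV, e, hxV⟩ := exists_affine_nhds x (V := f.left ⁻¹ᵁ U) hxU
  have hsm := f.left.smooth_appLE hU hV e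
  algebraize [(f.left.appLE U V e).hom]
  have ho := (isOpenMap_chart hU).comp
    (RPt.isOpenMap_comap_of_smooth (R := Γ(Y.left, U)) (S := Γ(X.left, V)))
  have h := ho.image_mem_nhds
    ((continuous_chart hV).continuousAt (x := evalPt x hxV) (by rwa [chart_evalPt]))
  have hc : ∀ ψ, (chart hU ∘ RPt.comap (algebraMap Γ(Y.left, U) Γ(X.left, V))) ψ =
      ptMap ℝ f (chart hV ψ) := fun ψ => (ptMap_chart f hU hV e ψ).symm
  rw [hc, chart_evalPt] at h
  refine mem_of_superset h ?_
  rintro _ ⟨ψ, hψ, rfl⟩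
  rw [hc]
  exact hψ

/-- The real points of a smooth scheme are locally connected. -/
theorem exists_isConnected_nhds_of_smooth (hX : Smooth X.hom) (x : Pt ℝ X) :
    ∃ N ∈ 𝓝 x, _root_.IsConnected N := by
  obtain ⟨V, hV, -, hxV⟩ := exists_affine_nhds x (V := ⊤) le_top
  have hsm := X.hom.smooth_appLE (isAffineOpen_top (Spec (.of ℝ))) hV le_top
  let θ : ℝ →+* Γ(X.left, V) := ((Scheme.ΓSpecIso (.of ℝ)).inv ≫ X.hom.appLE ⊤ V le_top).hom
  have hθ : θ.Smooth := RingHom.Smooth.respectsIso.2 _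
    (Scheme.ΓSpecIso (.of ℝ)).symm.commRingCatIsoToRingEquiv hsm
  algebraize [θ]
  have : Subsingleton (RPt ℝ) := inferInstanceAs (Subsingleton (ℝ →+* ℝ))
  obtain ⟨N, hN, hc⟩ := RPt.exists_isConnected_nhds_of_smooth (R := ℝ) (evalPt x hxV)
  have := (isOpenMap_chart hV).image_mem_nhds hN
  rw [chart_evalPt] at this
  exact ⟨_, this, hc.image _ (continuous_chart hV).continuousOn⟩

/-- A closed immersion which is bijective on real points is open on real points. -/
theorem isOpenMap_ptMap_of_isClosedImmersion (f : X ⟶ Y) [IsClosedImmersion f.left]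
    (hf : Function.Bijective (ptMap ℝ f)) : IsOpenMap (ptMap ℝ f) := by
  let e := Equiv.ofBijective _ hf
  suffices h : Continuous e.symm by
    intro O hO
    rw [show ptMap ℝ f '' O = e.symm ⁻¹' O from e.image_eq_preimage_symm O]
    exact hO.preimage h
  refine continuous_generateFrom_iff.2 ?_
  rintro _ ⟨U, s, W, hW, rfl⟩
  rw [← e.image_eq_preimage_symm, isOpen_iff_mem_nhds]
  rintro _ ⟨x, hx, rfl⟩
  obtain ⟨U', hU', hUe⟩ := f.left.isClosedEmbedding.isInducing.isOpen_iff.1 U.2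
  have hUe : ∀ p, f.left p ∈ U' ↔ p ∈ U := fun p => Set.ext_iff.1 hUe p
  obtain ⟨V, hV, hVU, hxV⟩ := exists_affine_nhds (ptMap ℝ f x) (V := ⟨U', hU'⟩)
    (top_le_preimage_iff.2 ((hUe _).2 (top_le_preimage_iff.1 hx.1)))
  have hVU' : f.left ⁻¹ᵁ V ≤ U := fun p hp => (hUe p).1 (hVU hp)
  -- Functions on a closed subscheme extend over affine opens, so a basic set of `X` is locally the
  -- trace of one of `Y`.
  obtain ⟨t, ht⟩ := f.left.app_surjective V hV (X.left.presheaf.map (homOfLE hVU').op s)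
  have key : ∀ y : Pt ℝ X, ⊤ ≤ (ptMap ℝ f y).left ⁻¹ᵁ V →
      (ptMap ℝ f y ∈ basicSet V t W ↔ y ∈ basicSet U s W) := by
    intro y hy
    rw [← mem_basicSet_of_le hVU' (x := y) hy, ← ht]
    refine exists_congr fun h => ?_
    have := Scheme.Hom.comp_appLE y.left f.left V ⊤ h
    exact iff_of_eq congr((Scheme.ΓSpecIso (.of ℝ)).hom.hom ($(this).hom t) ∈ W)
  have key' : ptMap ℝ f x ∈ basicSet V t W := (key x hxV).2 hx
  refine mem_of_superset ((isOpen_basicSet V t hW).mem_nhds key') fun y hy => ?_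
  obtain ⟨y, rfl⟩ := e.surjective y
  exact ⟨y, (key y hy.1).1 hy, rfl⟩

end RealGrp

namespace RealGrp

open Topology TopologicalSpace

/-! ### Reduced schemes -/

/-- Every scheme has a reduced closed subscheme with the same points. -/
theorem exists_reduced (X : Scheme.{0}) : ∃ (X' : Scheme.{0}) (r : X' ⟶ X), IsReduced X' ∧
    IsClosedImmersion r ∧ Surjective r := by
  refine ⟨X.nilradical.subscheme, X.nilradical.subschemeι, ?_, inferInstance, ?_⟩
  · have : ∀ i, IsReduced (X.nilradical.subschemeCover.openCover.X i) := fun U : X.affineOpens => by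
      have : _root_.IsReduced (Γ(X, U) ⧸ X.nilradical.ideal U) :=
        (Ideal.isRadical_iff_quotient_reduced _).1 (Ideal.radical_isRadical _)
      change IsReduced (Spec (.of (Γ(X, U) ⧸ X.nilradical.ideal U)))
      infer_instance
    exact IsReduced.of_openCover _ X.nilradical.subschemeCover.openCover
  · refine ⟨Set.range_eq_univ.1 ?_⟩
    rw [Scheme.IdealSheafData.range_subschemeι, Scheme.support_nilradical]
    rfl

/-- Morphisms from a reduced scheme lift along surjective closed immersions. -/
theorem exists_lift_of_isReduced {T X Z : Scheme.{0}} [IsReduced T] (r : Z ⟶ X)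
    [IsClosedImmersion r] [Surjective r] (g : T ⟶ X) : ∃ h : T ⟶ Z, h ≫ r = g := by
  refine ⟨IsClosedImmersion.lift r g ?_, IsClosedImmersion.lift_fac ..⟩
  -- Since r is surjective, its kernel is supported everywhere and so is nil; nilpotents die on the
  -- reduced `T`.
  have h1 : r.ker ≤ X.nilradical := by
    rw [← Scheme.IdealSheafData.vanishingIdeal_top,
      ← Scheme.IdealSheafData.le_support_iff_le_vanishingIdeal]
    intro x _
    obtain ⟨z, rfl⟩ := r.surjective x
    exact r.range_subset_ker_support ⟨z, rfl⟩
  refine h1.trans (Scheme.IdealSheafData.le_ofIdeals_iff.2 fun U s hs => ?_)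
  obtain ⟨n, hn⟩ := hs
  have hn : s ^ n = 0 := hn
  refine IsReduced.eq_zero _ ⟨n, ?_⟩
  rw [← map_pow, hn, map_zero]

/-- Schemes unramified and locally of finite type over a field are reduced. -/
theorem isReduced_of_formallyUnramified {K : Type} [Field K] {X : Scheme.{0}}
    (f : X ⟶ Spec (.of K)) [FormallyUnramified f] [LocallyOfFiniteType f] : IsReduced X := by
  have key : ∀ (R : CommRingCat) (g : Spec R ⟶ X) [IsOpenImmersion g], IsReduced (Spec R) := by
    intro R g _
    obtain ⟨φ, hφ⟩ := Spec.map_surjective (g ≫ f)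
    have h0 : FormallyUnramified (g ≫ f) := MorphismProperty.comp_mem _ g f inferInstance ‹_›
    have h1 : FormallyUnramified (Spec.map φ) := hφ ▸ inferInstance
    have h2 : LocallyOfFiniteType (Spec.map φ) := hφ ▸ inferInstance
    rw [HasRingHomProperty.Spec_iff (P := @FormallyUnramified)] at h1
    rw [HasRingHomProperty.Spec_iff (P := @LocallyOfFiniteType)] at h2
    let : Algebra K R := φ.hom.toAlgebra
    have : Algebra.FormallyUnramified K R := h1
    have : Algebra.FiniteType K R := h2
    have := Algebra.FormallyUnramified.isReduced_of_field K R
    infer_instance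
  have : ∀ i, IsReduced (X.affineCover.X i) := fun i => @key _ (X.affineCover.f i) (X.affineCover.map_prop i)
  exact IsReduced.of_openCover X X.affineCover

instance formallyUnramified_specComplex :
    FormallyUnramified (Spec.map (CommRingCat.ofHom (algebraMap ℝ ℂ))) := by
  rw [HasRingHomProperty.Spec_iff (P := @FormallyUnramified)]
  exact RingHom.formallyUnramified_algebraMap.2 (Algebra.FormallyUnramified.of_isSeparable ℝ ℂ)

instance locallyOfFiniteType_specComplex :
    LocallyOfFiniteType (Spec.map (CommRingCat.ofHom (algebraMap ℝ ℂ))) := by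
  rw [HasRingHomProperty.Spec_iff (P := @LocallyOfFiniteType)]
  exact RingHom.finiteType_algebraMap.2 inferInstance

instance flat_specComplex : Flat (Spec.map (CommRingCat.ofHom (algebraMap ℝ ℂ))) := by
  infer_instance

instance surjective_specComplex :
    Surjective (Spec.map (CommRingCat.ofHom (algebraMap ℝ ℂ))) := by
  infer_instance

/-- Base change of ℂ/ℝ to a field stays unramified and of finite type, hence reduced. This serves to
keep reduced real schemes reduced over ℂ. -/
instance geometricallyReduced_specComplex :
    GeometricallyReduced (Spec.map (CommRingCat.ofHom (algebraMap ℝ ℂ))) := by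
  refine ⟨fun K _ y Z fst snd h => ?_⟩
  have : FormallyUnramified snd := MorphismProperty.of_isPullback h inferInstance
  have : LocallyOfFiniteType snd := MorphismProperty.of_isPullback h inferInstance
  exact isReduced_of_formallyUnramified snd

/-! ### Generic smoothness in characteristic zero -/

theorem exists_isField_stalk {X Y : Scheme.{0}} [IsReduced X] [IsReduced Y] [Nonempty Y]
    (f : X ⟶ Y) [Surjective f] :
    ∃ x : X, IsField (X.presheaf.stalk x) ∧ IsField (Y.presheaf.stalk (f x)) := by
  obtain ⟨y₀⟩ := ‹Nonempty Y›
  obtain ⟨y, hy⟩ := QuasiSober.sober (isIrreducible_irreducibleComponent (x := y₀))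
    isClosed_irreducibleComponent
  obtain ⟨x₁, hx₁⟩ := f.surjective y
  obtain ⟨x, hx⟩ := QuasiSober.sober (isIrreducible_irreducibleComponent (x := x₁))
    isClosed_irreducibleComponent
  refine ⟨x, isField_stalk_of_closure_mem_irreducibleComponents _ _ ?_,
    isField_stalk_of_closure_mem_irreducibleComponents _ _ ?_⟩
  · rw [hx.def]
    exact irreducibleComponent_mem_irreducibleComponents _
  -- The point f(x) generizes the generic point y of a component, so by maximality of components it
  -- is generic as well.
  · have h1 : f x ⤳ y := by
      rw [← hx₁]
      exact (hx.specializes mem_irreducibleComponent).map f.continuous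
    have h2 : closure {f x} = irreducibleComponent y₀ := by
      refine (eq_irreducibleComponent isIrreducible_singleton.closure.isPreirreducible ?_)
      rw [← hy.def]
      exact closure_minimal (Set.singleton_subset_iff.2 h1.mem_closure) isClosed_closure
    rw [h2]
    exact irreducibleComponent_mem_irreducibleComponents _

/-- Extensions of a perfect field are formally smooth; θ only serves to give characteristic zero. -/
theorem formallySmooth_of_isField {A B : Type*} [CommRing A] [CommRing B] (φ : A →+* B)
    (hφ : φ.EssFiniteType) (hA : IsField A) (hB : IsField B) (θ : ℂ →+* A) :
    φ.FormallySmooth := by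
  algebraize [φ]
  let : Field A := hA.toField
  let : Field B := hB.toField
  have : CharZero A := charZero_of_injective_ringHom θ.injective
  exact Algebra.FormallySmooth.of_perfectField

theorem mem_smoothLocus_of_isField {X Y : Scheme.{0}} (f : X ⟶ Y) [LocallyOfFinitePresentation f]
    (h : Y ⟶ Spec (.of ℂ)) (x : X) (hx : IsField (X.presheaf.stalk x))
    (hy : IsField (Y.presheaf.stalk (f x))) : x ∈ f.smoothLocus :=
  Scheme.Hom.mem_smoothLocus.2 <| formallySmooth_of_isField _ (LocallyOfFiniteType.stalkMap f x)
    hy hx ((Scheme.ΓSpecIso (.of ℂ)).inv ≫ h.appTop ≫ Y.presheaf.germ ⊤ (f x) trivial).hom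

/-- Smoothness at α(x) makes α ≫ f = f ≫ β smooth at x, and the isomorphism β cancels on stalks. -/
theorem preimage_smoothLocus_of_commSq {X Y : Scheme.{0}} (f : X ⟶ Y)
    [LocallyOfFinitePresentation f] (α : X ⟶ X) (β : Y ⟶ Y) [IsIso α] [IsIso β]
    (h : α ≫ f = f ≫ β) {x : X} (hx : α x ∈ f.smoothLocus) : x ∈ f.smoothLocus := by
  have key : ∀ (g : X ⟶ Y) [LocallyOfFinitePresentation g], α ≫ f = g → x ∈ g.smoothLocus := by
    rintro g _ rfl
    rw [← Scheme.Hom.preimage_smoothLocus_eq]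
    exact hx
  have h2 := Scheme.Hom.mem_smoothLocus.1 (key _ h)
  rw [Scheme.Hom.mem_smoothLocus]
  rw [Scheme.Hom.stalkMap_comp] at h2
  exact (RingHom.FormallySmooth.respectsIso.cancel_left_isIso (β.stalkMap (f x)) (f.stalkMap x)).1 h2

/-- A surjective morphism of reduced complex schemes is smooth if its automorphisms permute the
closed points transitively. -/
theorem smooth_of_transitive {X Y : Scheme.{0}} [IsReduced X] [IsReduced Y] (f : X ⟶ Y)
    [Surjective f] (h : Y ⟶ Spec (.of ℂ)) [LocallyOfFiniteType h] [LocallyOfFiniteType f]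
    (H : ∀ x y : X, IsClosed {x} → IsClosed {y} → ∃ (α : X ⟶ X) (β : Y ⟶ Y), IsIso α ∧ IsIso β ∧
      α ≫ f = f ≫ β ∧ α x = y) : Smooth f := by
  have : IsLocallyNoetherian Y := LocallyOfFiniteType.isLocallyNoetherian h
  have : LocallyOfFinitePresentation f :=
    LocallyOfFinitePresentation.iff_locallyOfFiniteType.2 inferInstance
  have := LocallyOfFiniteType.jacobsonSpace (f ≫ h)
  rw [← Scheme.Hom.smoothLocus_eq_top_iff, ← Opens.coe_eq_univ, ← not_ne_iff,
    ← Set.nonempty_compl]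
  intro hne
  -- `X` is Jacobson, so both the nonempty closed complement and the nonempty smooth locus contain
  -- closed points of `X`; an automorphism carrying one to the other gives the contradiction.
  obtain ⟨x, hx, hxc⟩ :=
    nonempty_inter_closedPoints hne f.smoothLocus.2.isClosed_compl.isLocallyClosed
  have : Nonempty Y := ⟨f x⟩
  obtain ⟨ξ, h1, h2⟩ := exists_isField_stalk f
  obtain ⟨y, hy, hyc⟩ := nonempty_inter_closedPoints
    (⟨ξ, mem_smoothLocus_of_isField f h ξ h1 h2⟩ : (f.smoothLocus : Set X).Nonempty)
    f.smoothLocus.2.isLocallyClosed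
  obtain ⟨α, β, _, _, hαβ, rfl⟩ := H x y hxc hyc
  exact hx (preimage_smoothLocus_of_commSq f α β hαβ hy)

end RealGrp

namespace RealGrp

open Topology TopologicalSpace

/-! ### Base change to the complex numbers -/

theorem isPullback_whiskerRight {X Y : RSch} (f : X ⟶ Y) (T : RSch) :
    IsPullback (f ▷ T) (fst X T) (fst Y T) f :=
  ⟨⟨whiskerRight_fst f T⟩, ⟨PullbackCone.IsLimit.mk _ (fun s => lift s.snd (s.fst ≫ snd Y T))
    (fun s => by
      ext1
      · simp [s.condition]
      · simp)
    (fun s => by simp)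
    (fun s m h1 h2 => by
      ext1
      · simp [← h2]
      · simp [← h1])⟩⟩

theorem isPullback_whiskerRight_left {X Y : RSch} (f : X ⟶ Y) (T : RSch) :
    IsPullback (f ▷ T).left (fst X T).left (fst Y T).left f.left :=
  (isPullback_whiskerRight f T).map (Over.forget _)

/-- Faithfully flat quasi-compact descent along the projection from the complexification of `Y`. -/
theorem smooth_of_whiskerRight {X Y : RSch} (f : X ⟶ Y) [h : Smooth (f ▷ specOver ℂ).left] :
    Smooth f.left := by
  refine MorphismProperty.of_isPullback_of_descendsAlong
    (Q := @Surjective ⊓ @Flat ⊓ @QuasiCompact) (isPullback_whiskerRight_left f (specOver ℂ)) ?_ h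
  refine ⟨⟨?_, ?_⟩, ?_⟩
  · exact inferInstanceAs (Surjective (pullback.fst Y.hom
      (Spec.map (CommRingCat.ofHom (algebraMap ℝ ℂ)))))
  · exact inferInstanceAs (Flat (pullback.fst Y.hom
      (Spec.map (CommRingCat.ofHom (algebraMap ℝ ℂ)))))
  · exact inferInstanceAs (QuasiCompact (pullback.fst Y.hom
      (Spec.map (CommRingCat.ofHom (algebraMap ℝ ℂ)))))

instance locallyOfFiniteType_snd_left (X : RSch) [LocallyOfFiniteType X.hom] :
    LocallyOfFiniteType (snd X (specOver ℂ)).left :=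
  inferInstanceAs (LocallyOfFiniteType (pullback.snd X.hom
      (Spec.map (CommRingCat.ofHom (algebraMap ℝ ℂ)))))

theorem isReduced_tensor_specComplex (X : RSch) [LocallyOfFiniteType X.hom] [IsReduced X.left] :
    IsReduced (X ⊗ specOver ℂ).left := by
  have : IsLocallyNoetherian X.left := LocallyOfFiniteType.isLocallyNoetherian X.hom
  exact inferInstanceAs (IsReduced (pullback X.hom
      (Spec.map (CommRingCat.ofHom (algebraMap ℝ ℂ)))))

/-- The `ℂ`-morphism corresponding to a closed point of a complex base change. -/
theorem exists_point_of_isClosed (X : RSch) [LocallyOfFiniteType X.hom]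
    (x : ↥(X ⊗ specOver ℂ).left) (hx : IsClosed {x}) :
    ∃ P : specOver ℂ ⟶ X ⊗ specOver ℂ, P ≫ snd _ _ = 𝟙 _ ∧
      P.left (IsLocalRing.closedPoint ℂ) = x := by
  let g : (X ⊗ specOver ℂ).left ⟶ Spec (.of ℂ) := (snd X (specOver ℂ)).left
  have : LocallyOfFiniteType g := locallyOfFiniteType_snd_left X
  let p := pointOfClosedPoint g x hx
  have hp : p ≫ g = 𝟙 _ := pointOfClosedPoint_comp g x hx
  refine ⟨Over.homMk p ?_, ?_, pointOfClosedPoint_apply g x hx _⟩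
  · have : g ≫ (specOver ℂ).hom = (X ⊗ specOver ℂ).hom := Over.w (snd X (specOver ℂ))
    rw [← this, ← Category.assoc, hp]
    exact Category.id_comp _
  · ext1
    exact hp

/-! ### Translations by T-valued points -/

section Translation

variable {G H : RSch} [GrpObj G] [GrpObj H] {T : RSch}

/-- Right translation of `G × T` by a `T`-point of `G`. -/
noncomputable def translation (b : T ⟶ G) : G ⊗ T ⟶ G ⊗ T := lift (fst G T * (snd G T ≫ b)) (snd G T)

theorem translation_comp (b c : T ⟶ G) : translation b ≫ translation c = translation (b * c) := by
  unfold translation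
  ext1
  · simp only [Category.assoc, lift_fst, MonObj.comp_mul]
    rw [lift_snd_assoc, _root_.mul_assoc]
  · simp

theorem translation_one : translation (1 : T ⟶ G) = 𝟙 _ := by
  unfold translation
  ext1
  · simp [MonObj.comp_one]
  · simp

/-- Right translation as an isomorphism. -/
noncomputable def translationIso (b : T ⟶ G) : G ⊗ T ≅ G ⊗ T where
  hom := translation b
  inv := translation b⁻¹
  hom_inv_id := by rw [translation_comp, mul_inv_cancel, translation_one]
  inv_hom_id := by rw [translation_comp, inv_mul_cancel, translation_one]

theorem translation_whiskerRight (j : G ⟶ H) [IsMonHom j] (b : T ⟶ G) :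
    translation b ≫ (j ▷ T) = (j ▷ T) ≫ translation (b ≫ j) := by
  unfold translation
  ext1
  · simp only [Category.assoc, lift_fst, whiskerRight_fst, MonObj.comp_mul, lift_fst_assoc,
      whiskerRight_snd_assoc]
    have := map_mul (IsMonHom.monoidHom j (G ⊗ T)) (fst G T) (snd G T ≫ b)
    simpa using this
  · simp

theorem comp_whiskerRight_translation {X : RSch} (q : X ⟶ G) (P P' : T ⟶ X ⊗ T)
    (hP : P ≫ snd _ _ = 𝟙 _) (hP' : P' ≫ snd _ _ = 𝟙 _) :
    P ≫ (q ▷ T) ≫ translation ((P ≫ fst _ _ ≫ q)⁻¹ * (P' ≫ fst _ _ ≫ q)) = P' ≫ (q ▷ T) := by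
  unfold translation
  ext1
  · simp only [Category.assoc, lift_fst, whiskerRight_fst, MonObj.comp_mul,
      whiskerRight_snd_assoc, reassoc_of% hP]
    rw [mul_inv_cancel_left]
  · simp [hP, hP']

end Translation

/-- This lets translations act on the reduced subscheme without giving it a group structure. -/
theorem exists_iso_lift_of_isReduced {X Z : Scheme.{0}} [IsReduced X] (r : X ⟶ Z)
    [IsClosedImmersion r] [Surjective r] (σ : Z ≅ Z) : ∃ α : X ⟶ X, IsIso α ∧ α ≫ r = r ≫ σ.hom := by
  obtain ⟨α, hα⟩ := exists_lift_of_isReduced r (r ≫ σ.hom)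
  obtain ⟨β, hβ⟩ := exists_lift_of_isReduced r (r ≫ σ.inv)
  refine ⟨α, ⟨β, ?_, ?_⟩, hα⟩
  · rw [← cancel_mono r, Category.assoc, hβ, reassoc_of% hα]
    simp
  · rw [← cancel_mono r, Category.assoc, hα, reassoc_of% hβ]
    simp

/-- A surjective homomorphism of real algebraic groups is smooth on the underlying reduced
schemes. -/
theorem smooth_reduced_of_surjective {G H : RSch} [GrpObj G] [GrpObj H]
    [LocallyOfFiniteType G.hom] [LocallyOfFiniteType H.hom] (j : G ⟶ H) [IsMonHom j]
    [Surjective j.left] {X Y : RSch} [IsReduced X.left] [IsReduced Y.left] (p : X ⟶ G) (q : Y ⟶ H)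
    [IsClosedImmersion p.left] [Surjective p.left] [IsClosedImmersion q.left] [Surjective q.left]
    (f : X ⟶ Y) (hf : f ≫ q = p ≫ j) : Smooth f.left := by
  have hlX : LocallyOfFiniteType X.hom := by
    rw [← Over.w p]; exact MorphismProperty.comp_mem _ _ _ inferInstance ‹_›
  have hlY : LocallyOfFiniteType Y.hom := by
    rw [← Over.w q]; exact MorphismProperty.comp_mem _ _ _ inferInstance ‹_›
  have hfs : Surjective f.left := by
    refine ⟨fun y => ?_⟩
    obtain ⟨g, hg⟩ := j.left.surjective (q.left y)
    obtain ⟨x, rfl⟩ := p.left.surjective g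
    refine ⟨x, q.left.isClosedEmbedding.injective ?_⟩
    rw [← hg]
    exact congr($(hf).left x)
  have hfl : LocallyOfFiniteType f.left := by
    have : LocallyOfFiniteType (f.left ≫ Y.hom) := by rw [Over.w]; infer_instance
    exact locallyOfFiniteType_of_comp f.left Y.hom
  let T := specOver ℂ
  have : IsReduced (X ⊗ T).left := isReduced_tensor_specComplex X
  have : IsReduced (Y ⊗ T).left := isReduced_tensor_specComplex Y
  have : IsClosedImmersion (p ▷ T).left :=
    MorphismProperty.of_isPullback (isPullback_whiskerRight_left p T).flip ‹_›
  have : IsClosedImmersion (q ▷ T).left :=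
    MorphismProperty.of_isPullback (isPullback_whiskerRight_left q T).flip ‹_›
  have : Surjective (p ▷ T).left :=
    MorphismProperty.of_isPullback (isPullback_whiskerRight_left p T).flip ‹_›
  have : Surjective (q ▷ T).left :=
    MorphismProperty.of_isPullback (isPullback_whiskerRight_left q T).flip ‹_›
  have : Surjective (f ▷ T).left :=
    MorphismProperty.of_isPullback (isPullback_whiskerRight_left f T).flip ‹_›
  have : LocallyOfFiniteType (f ▷ T).left :=
    MorphismProperty.of_isPullback (isPullback_whiskerRight_left f T).flip ‹_›
  have hfT : (f ▷ T) ≫ (q ▷ T) = (p ▷ T) ≫ (j ▷ T) := by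
    rw [← comp_whiskerRight, ← comp_whiskerRight, hf]
  suffices Smooth (f ▷ T).left from smooth_of_whiskerRight f
  refine smooth_of_transitive (f ▷ T).left (snd Y T).left fun x y hx hy => ?_
  obtain ⟨P, hP, rfl⟩ := exists_point_of_isClosed X x hx
  obtain ⟨P', hP', rfl⟩ := exists_point_of_isClosed X y hy
  -- Right translation by c carries the image of `P` to that of `P'`, and translation by j(c) is its
  -- counterpart on `H`.
  let c : T ⟶ G := (P ≫ fst _ _ ≫ p)⁻¹ * (P' ≫ fst _ _ ≫ p)
  obtain ⟨α, hα, hαc⟩ := exists_iso_lift_of_isReduced (p ▷ T).left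
    ((Over.forget _).mapIso (translationIso c))
  obtain ⟨β, hβ, hβc⟩ := exists_iso_lift_of_isReduced (q ▷ T).left
    ((Over.forget _).mapIso (translationIso (c ≫ j)))
  replace hαc : α ≫ (p ▷ T).left = (p ▷ T).left ≫ (translation c).left := hαc
  replace hβc : β ≫ (q ▷ T).left = (q ▷ T).left ≫ (translation (c ≫ j)).left := hβc
  have hfT' : (f ▷ T).left ≫ (q ▷ T).left = (p ▷ T).left ≫ (j ▷ T).left := congr_arg (·.left) hfT
  have htr : (translation c).left ≫ (j ▷ T).left = (j ▷ T).left ≫ (translation (c ≫ j)).left :=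
    congr_arg (·.left) (translation_whiskerRight j c)
  refine ⟨α, β, hα, hβ, ?_, ?_⟩
  · rw [← cancel_mono (q ▷ T).left, Category.assoc, Category.assoc, hfT', hβc, reassoc_of% hαc,
      reassoc_of% hfT', htr]
  · apply (p ▷ T).left.isClosedEmbedding.injective
    have h1 : P.left ≫ (p ▷ T).left ≫ (translation c).left = P'.left ≫ (p ▷ T).left :=
      congr_arg (·.left) (comp_whiskerRight_translation p P P' hP hP')
    rw [← hαc] at h1
    exact congr($h1 (IsLocalRing.closedPoint ℂ))

/-- The reduced subscheme of a scheme over `ℝ`. -/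
theorem exists_reduced_over (X : RSch) : ∃ (X' : RSch) (r : X' ⟶ X), IsReduced X'.left ∧
    IsClosedImmersion r.left ∧ Surjective r.left := by
  obtain ⟨X', r, h1, h2, h3⟩ := exists_reduced X.left
  exact ⟨Over.mk (r ≫ X.hom), Over.homMk r, h1, h2, h3⟩

theorem exists_lift_over {T X Z : RSch} [IsReduced T.left] (r : Z ⟶ X)
    [IsClosedImmersion r.left] [Surjective r.left] (g : T ⟶ X) : ∃ h : T ⟶ Z, h ≫ r = g := by
  obtain ⟨h, hh⟩ := exists_lift_of_isReduced r.left g.left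
  refine ⟨Over.homMk h ?_, ?_⟩
  · rw [← Over.w r, reassoc_of% hh, Over.w]
  · ext1
    exact hh

theorem bijective_ptMap {X Z : RSch} (r : Z ⟶ X) [IsClosedImmersion r.left]
    [Surjective r.left] : Function.Bijective (ptMap ℝ r) := by
  have : IsReduced (specOver ℝ).left := inferInstanceAs (IsReduced (Spec _))
  refine ⟨fun x y h => ?_, exists_lift_over r⟩
  ext1
  rw [← cancel_mono r.left]
  exact congr_arg (·.left) h

/-- A surjective homomorphism of real algebraic groups is open on real points. -/
theorem isOpenMap_ptMap_of_surjective {G H : RSch} [GrpObj G] [GrpObj H]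
    [LocallyOfFiniteType G.hom] [LocallyOfFiniteType H.hom] (j : G ⟶ H) [IsMonHom j]
    [Surjective j.left] : IsOpenMap (ptMap ℝ j) := by
  obtain ⟨X, p, _, _, _⟩ := exists_reduced_over G
  obtain ⟨Y, q, _, _, _⟩ := exists_reduced_over H
  obtain ⟨f, hf⟩ := exists_lift_over q (p ≫ j)
  have := smooth_reduced_of_surjective j p q f hf
  have hc : ptMap ℝ j ∘ ptMap ℝ p = ptMap ℝ q ∘ ptMap ℝ f := by
    funext x
    simp only [Function.comp_apply, ptMap, Category.assoc, hf]
  intro O hO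
  rw [← Set.image_preimage_eq O (bijective_ptMap p).2, ← Set.image_comp, hc]
  refine (isOpenMap_ptMap_of_isClosedImmersion q (bijective_ptMap q)).comp
    (isOpenMap_ptMap_of_smooth f) _ (hO.preimage (continuous_ptMap p))

/-- The identity component is open. -/
theorem isOpen_identityComponent (G : RSch) [GrpObj G] [LocallyOfFiniteType G.hom] :
    IsOpen (identityComponent G : Set (Pt ℝ G)) := by
  obtain ⟨X, p, _, _, _⟩ := exists_reduced_over G
  -- The smoothness theorem is applied to the surjective homomorphism from `G` to the trivial group,
  -- so that the reduced scheme `X` is smooth over ℝ.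
  have h1 : IsReduced (𝟙_ RSch).left := inferInstanceAs (IsReduced (Spec _))
  have h2 : Surjective (toUnit G).left := by
    refine ⟨fun x => ⟨(η[G] : 𝟙_ RSch ⟶ G).left x, ?_⟩⟩
    have : η[G] ≫ toUnit G = 𝟙 (𝟙_ RSch) := toUnit_unique _ _
    exact congr($(this).left x)
  have hl : LocallyOfFiniteType (𝟙_ RSch).hom :=
    inferInstanceAs (LocallyOfFiniteType (𝟙 (Spec (.of ℝ))))
  have : IsClosedImmersion (𝟙 (𝟙_ RSch) : 𝟙_ RSch ⟶ 𝟙_ RSch).left :=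
    inferInstanceAs (IsClosedImmersion (𝟙 (Spec (.of ℝ))))
  have : Surjective (𝟙 (𝟙_ RSch) : 𝟙_ RSch ⟶ 𝟙_ RSch).left :=
    inferInstanceAs (Surjective (𝟙 (Spec (.of ℝ))))
  have hX : Smooth (toUnit X).left :=
    smooth_reduced_of_surjective (toUnit G) p (𝟙 _) (toUnit X) (toUnit_unique _ _)
  obtain ⟨e, he⟩ := (bijective_ptMap p).2 1
  obtain ⟨N, hN, hc⟩ := exists_isConnected_nhds_of_smooth (X := X) hX e
  have hN' := (isOpenMap_ptMap_of_isClosedImmersion p (bijective_ptMap p)).image_mem_nhds hN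
  have hsub : ptMap ℝ p '' N ⊆ connectedComponent (1 : Pt ℝ G) :=
    (hc.image _ (continuous_ptMap p).continuousOn).isPreconnected.subset_connectedComponent
      ⟨e, mem_of_mem_nhds hN, he⟩
  rw [he] at hN'
  refine isOpen_iff_mem_nhds.2 fun g hg => ?_
  have h3 : (fun x => g⁻¹ * x) ⁻¹' (connectedComponent (1 : Pt ℝ G)) ∈ 𝓝 g := by
    refine (continuous_mulLeft G g⁻¹).continuousAt ?_
    rw [inv_mul_cancel]
    exact Filter.mem_of_superset hN' hsub
  refine Filter.mem_of_superset h3 fun x hx => ?_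
  have := (identityComponent G).mul_mem hg (show g⁻¹ * x ∈ identityComponent G from hx)
  rwa [mul_inv_cancel_left] at this

end RealGrp

namespace RealGrp

open Topology TopologicalSpace

/-! ### Galois descent for points -/

theorem toComplex_injective (X : RSch) : Function.Injective (toComplex (X := X)) := by
  intro x y h
  have h : Spec.map (CommRingCat.ofHom (algebraMap ℝ ℂ)) ≫ x.left =
    Spec.map (CommRingCat.ofHom (algebraMap ℝ ℂ)) ≫ y.left := congr_arg (·.left) h
  ext1
  have : Epi (Spec.map (CommRingCat.ofHom (algebraMap ℝ ℂ))) := by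
    have := Flat.epi_of_flat_of_surjective (Spec.map (CommRingCat.ofHom (algebraMap ℝ ℂ)))
    infer_instance
  exact (cancel_epi _).1 h

/-- On an affine open containing the point, invariance says that all functions take real values
there, so taking real parts is a ring homomorphism. -/
theorem exists_toComplex_eq {X : RSch} (x : Pt ℂ X) (hx : specConj ≫ x = x) :
    ∃ y : Pt ℝ X, toComplex y = x := by
  let x' : Spec (.of ℂ) ⟶ X.left := x.left
  obtain ⟨_, ⟨U, hU, rfl⟩, hxU, -⟩ := X.left.isBasis_affineOpens.exists_subset_of_mem_open
    (Set.mem_univ (x' (IsLocalRing.closedPoint ℂ))) isOpen_univ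
  have hle : ⊤ ≤ x' ⁻¹ᵁ U := fun p _ => by
    rwa [Subsingleton.elim p (IsLocalRing.closedPoint ℂ)]
  let φ : Γ(X.left, U) ⟶ .of ℂ := x'.appLE U ⊤ hle ≫ (Scheme.ΓSpecIso (.of ℂ)).hom
  have hφ : Spec.map φ ≫ hU.fromSpec = x' := specMap_appLE_comp_fromSpec x' hU hle
  have hc : φ ≫ CommRingCat.ofHom (starRingEnd ℂ) = φ := by
    apply Spec.map_injective
    have : Mono hU.fromSpec := have := hU.isOpenImmersion_fromSpec; inferInstance
    rw [← cancel_mono hU.fromSpec, Spec.map_comp, Category.assoc, hφ]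
    exact congr_arg (·.left) hx
  have hre : ∀ s, ((φ.hom s).re : ℂ) = φ.hom s := fun s =>
    Complex.conj_eq_iff_re.1 congr($(hc).hom s)
  let ψ : Γ(X.left, U) →+* ℝ :=
    { toFun := fun s => (φ.hom s).re
      map_one' := by simp
      map_zero' := by simp
      map_add' := fun a b => by simp
      map_mul' := fun a b => by
        apply Complex.ofReal_injective
        rw [Complex.ofReal_mul, hre, hre, hre, map_mul] }
  refine ⟨chart hU ψ, ?_⟩
  ext1
  change Spec.map (CommRingCat.ofHom (algebraMap ℝ ℂ)) ≫ Spec.map (CommRingCat.ofHom ψ) ≫ _ = x'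
  rw [← hφ, ← Category.assoc, ← Spec.map_comp]
  congr 2
  ext s
  exact hre s

/-! ### Exactness at each term -/

section Exact

variable {A B C : RSch} [GrpObj A] [GrpObj B] [GrpObj C] {i : A ⟶ B} {j : B ⟶ C}

theorem toComplex_mul (x y : Pt ℝ B) : toComplex (x * y) = toComplex x * toComplex y :=
  MonObj.comp_mul _ _ _

variable [IsMonHom j]

theorem ptHom_toComplex (x : Pt ℝ B) : ptHom ℂ j (toComplex x) = toComplex (ptHom ℝ j x) :=
  Category.assoc specIncl x j

/-- The image of the identity component under a surjective homomorphism contains the identity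
component. -/
theorem identityComponent_le_map [LocallyOfFiniteType B.hom] [LocallyOfFiniteType C.hom]
    [Surjective j.left] : identityComponent C ≤ (identityComponent B).map (ptHom ℝ j) := by
  have ho : IsOpen ((identityComponent B).map (ptHom ℝ j) : Set (Pt ℝ C)) :=
    isOpenMap_ptMap_of_surjective j _ (isOpen_identityComponent B)
  -- An open subgroup is closed: the coset of any g outside it is a neighbourhood of g missing it.
  refine IsClopen.connectedComponent_subset ⟨⟨isOpen_iff_mem_nhds.2 fun g hg => ?_⟩, ho⟩
    (one_mem ((identityComponent B).map (ptHom ℝ j)))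
  refine Filter.mem_of_superset ((continuous_mulLeft C g⁻¹).continuousAt (x := g)
    (by rw [inv_mul_cancel]; exact ho.mem_nhds (one_mem _))) fun x hx hxK => hg ?_
  have h1 : x * (g⁻¹ * x)⁻¹ ∈ (identityComponent B).map (ptHom ℝ j) :=
    mul_mem hxK (inv_mem (show g⁻¹ * x ∈ (identityComponent B).map (ptHom ℝ j) from hx))
  simpa using h1

variable [IsMonHom i]

theorem ptHom_comp_eq_one (hS : IsShortExact i j) (K : Type) [CommRing K] [Algebra ℝ K]
    (a : Pt K A) : ptHom K j (ptHom K i a) = 1 := by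
  change (a ≫ i) ≫ j = _
  rw [Category.assoc, hS.kernel.w, ← Category.assoc, toUnit_unique (a ≫ toUnit A) (toUnit _)]
  rfl

theorem H1.mk_eq_one_iff {M : Type} [Group M] {σ : M →* M} {a : Z1 σ} :
    H1.mk a = 1 ↔ ∃ x : M, a.1 = x * (σ x)⁻¹ := by
  rw [eq_comm]
  refine (Quotient.eq (r := cohomologous σ)).trans (exists_congr fun x => ?_)
  simp

theorem H1.mk_surjective {M : Type} [Group M] {σ : M →* M} (h : H1 σ) : ∃ a : Z1 σ, H1.mk a = h :=
  Quotient.exists_rep h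

variable [LocallyOfFiniteType B.hom]

/-- If b' lifts c, then bb' lifts j(b)c, and the real factor b cancels in (bb')⁻¹ · ᵞ(bb'). -/
theorem connecting_ptHom_mul (hS : IsShortExact i j) (b : Pt ℝ B) (c : Pt ℝ C) :
    connecting hS (ptHom ℝ j b * c) = connecting hS c := by
  obtain ⟨b', a, h1, h2, h3⟩ := (connecting_spec hS c _).1 rfl
  refine (connecting_spec hS _ _).2 ⟨toComplex b * b', a, ?_, ?_, h3⟩
  · rw [map_mul, h1, ptHom_toComplex, toComplex_mul]
  · rw [h2, map_mul, conj_toComplex]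
    group

theorem connecting_eq_one_iff (hS : IsShortExact i j) (c : Pt ℝ C) :
    connecting hS c = 1 ↔ ∃ b : Pt ℝ B, ptHom ℝ j b = c := by
  constructor
  · intro h
    obtain ⟨b, a, h1, h2, h3⟩ := (connecting_spec hS c _).1 h
    obtain ⟨x, hx⟩ := H1.mk_eq_one_iff.1 h3.symm
    -- From b⁻¹ · ᵞb = i(x) · ᵞi(x)⁻¹ it follows that b · i(x) is fixed by conjugation: it is a real
    -- lift of c.
    obtain ⟨b₀, hb₀⟩ := exists_toComplex_eq (b * ptHom ℂ i x) (by
      change conj B (b * ptHom ℂ i x) = _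
      rw [hx, map_mul, map_inv, conj_ptHom] at h2
      rw [map_mul]
      have : conj B b = b * (ptHom ℂ i x * (conj B (ptHom ℂ i x))⁻¹) := by rw [h2]; group
      rw [this]
      group)
    refine ⟨b₀, toComplex_injective _ ?_⟩
    rw [← ptHom_toComplex, hb₀, map_mul, h1, ptHom_comp_eq_one hS, _root_.mul_one]
  · rintro ⟨b, rfl⟩
    exact (connecting_spec hS _ _).2 ⟨toComplex b, ⟨1, by simp⟩, ptHom_toComplex b, by
      rw [conj_toComplex, map_one, inv_mul_cancel], rfl⟩

theorem galH1Map_eq_one_iff (hS : IsShortExact i j) (h : galH1 A) :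
    galH1Map i h = 1 ↔ ∃ c : Pt ℝ C, connecting hS c = h := by
  constructor
  · obtain ⟨a, rfl⟩ := H1.mk_surjective h
    intro h
    obtain ⟨x, hx⟩ := H1.mk_eq_one_iff.1 h
    have hx : ptHom ℂ i a.1 = x * (conj B x)⁻¹ := hx
    have hj : ptHom ℂ j (conj B x) = ptHom ℂ j x := by
      have h1 := ptHom_comp_eq_one hS ℂ a.1
      rw [hx, map_mul, map_inv] at h1
      exact (mul_inv_eq_one.1 h1).symm
    -- The inverse appears because x · ᵞx⁻¹ has the form b⁻¹ · ᵞb for b = x⁻¹.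
    obtain ⟨c, hc⟩ := exists_toComplex_eq (ptHom ℂ j x⁻¹) (by
      change conj C (ptHom ℂ j x⁻¹) = _
      rw [← conj_ptHom, map_inv, map_inv, hj, map_inv])
    exact ⟨c, (connecting_spec hS _ _).2 ⟨x⁻¹, a, hc.symm, by rw [hx, map_inv, inv_inv], rfl⟩⟩
  · rintro ⟨c, rfl⟩
    obtain ⟨b, a, -, h2, h3⟩ := (connecting_spec hS c _).1 rfl
    rw [h3]
    refine H1.mk_eq_one_iff.2 ⟨b⁻¹, ?_⟩
    rw [map_inv, inv_inv]
    exact h2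

theorem exactAt_galH1Map (hS : IsShortExact i j) : ExactAt (galH1Map i) (galH1Map j) := by
  intro h
  constructor
  · obtain ⟨β, rfl⟩ := H1.mk_surjective h
    intro h
    obtain ⟨c, hc⟩ := H1.mk_eq_one_iff.1 h
    have hc : ptHom ℂ j β.1 = c * (conj C c)⁻¹ := hc
    have := hS.surjective
    obtain ⟨b, hb⟩ := exists_lift j c
    have hb : ptHom ℂ j b = c := hb
    -- Changing β by a lift of the trivializing element c moves it into the kernel of j.
    obtain ⟨a, ha⟩ := exists_preimage hS (b := b⁻¹ * β.1 * conj B b) (by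
      rw [map_mul, map_mul, map_inv, conj_ptHom, hb, hc]
      group)
    have hz : a * conj A a = 1 := by
      apply ptHom_injective hS ℂ
      rw [map_mul, conj_ptHom, ha, map_mul, map_mul, conj_conj, map_inv, map_one]
      have : conj B β.1 = (β.1)⁻¹ := (inv_eq_of_mul_eq_one_right β.2).symm
      rw [this]
      group
    refine ⟨H1.mk ⟨a, hz⟩, Quotient.sound (s := cohomologous (conj B)) ⟨b, ?_⟩⟩
    change β.1 = b * ptHom ℂ i a * _
    rw [ha]
    group
  · rintro ⟨x, rfl⟩
    obtain ⟨a, rfl⟩ := H1.mk_surjective x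
    refine H1.mk_eq_one_iff.2 ⟨1, ?_⟩
    rw [map_one, inv_one, _root_.mul_one]
    exact ptHom_comp_eq_one hS ℂ a.1

variable [LocallyOfFiniteType C.hom]

theorem connecting_eq_of_leftRel (hS : IsShortExact i j) (c c' : Pt ℝ C)
    (h : c⁻¹ * c' ∈ identityComponent C) : connecting hS c = connecting hS c' := by
  have := hS.surjective
  -- π₀ is formed with left cosets, while δ is invariant under left multiplication by j(B(ℝ));
  -- normality passes between the two.
  have h1 : c' * c⁻¹ ∈ identityComponent C := by
    have := Subgroup.Normal.conj_mem (inferInstance : (identityComponent C).Normal) _ h c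
    simpa [← _root_.mul_assoc] using this
  obtain ⟨b, -, hb⟩ := identityComponent_le_map (j := j) h1
  have hc : c' = ptHom ℝ j b * c := by rw [hb]; group
  rw [hc, connecting_ptHom_mul]

theorem exactAt_pi0Map (hS : IsShortExact i j) : ExactAt (pi0Map i) (pi0Map j) := by
  have := hS.surjective
  intro y
  obtain ⟨b, rfl⟩ := QuotientGroup.mk_surjective y
  constructor
  · intro h
    have hb : ptHom ℝ j b ∈ identityComponent C := (QuotientGroup.eq_one_iff _).1 h
    -- Dividing b by an element of B(ℝ)⁰ with the same image keeps its component and lands in the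
    -- kernel of j.
    obtain ⟨b₀, hb₀, hbb⟩ := identityComponent_le_map (j := j) hb
    obtain ⟨a, ha⟩ := exists_preimage hS (b := b * b₀⁻¹) (by
      rw [map_mul, map_inv, hbb, mul_inv_cancel])
    refine ⟨QuotientGroup.mk a, QuotientGroup.eq.2 ?_⟩
    rw [ha]
    simpa using hb₀
  · rintro ⟨x, hx⟩
    rw [← hx]
    obtain ⟨a, rfl⟩ := QuotientGroup.mk_surjective x
    exact congr_arg QuotientGroup.mk (ptHom_comp_eq_one hS ℝ a)

end Exact

end RealGrp

theorem mainTheorem10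
    (A B C : RSch) [GrpObj A] [GrpObj B] [GrpObj C]
    [LocallyOfFiniteType A.hom] [QuasiCompact A.hom]
    [LocallyOfFiniteType B.hom] [QuasiCompact B.hom]
    [LocallyOfFiniteType C.hom] [QuasiCompact C.hom]
    (i : A ⟶ B) (j : B ⟶ C) [IsMonHom i] [IsMonHom j] (hS : IsShortExact i j) :
    ∃ δ₀ : pi0 C → galH1 A,
      (∀ c : Pt ℝ C, δ₀ (QuotientGroup.mk c) = connecting hS c) ∧
      ExactAt (pi0Map i) (pi0Map j) ∧
      ExactAt (pi0Map j) δ₀ ∧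
      ExactAt δ₀ (galH1Map i) ∧
      ExactAt (galH1Map i) (galH1Map j) := by
  refine ⟨Quotient.lift (connecting hS) fun c c' h =>
    connecting_eq_of_leftRel hS c c' (QuotientGroup.leftRel_apply.1 h), fun c => rfl,
    exactAt_pi0Map hS, fun y => ?_, fun h => ?_, exactAt_galH1Map hS⟩
  · obtain ⟨c, rfl⟩ := QuotientGroup.mk_surjective y
    refine (connecting_eq_one_iff hS c).trans ⟨?_, ?_⟩
    · rintro ⟨b, rfl⟩
      exact ⟨QuotientGroup.mk b, rfl⟩
    · rintro ⟨x, hx⟩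
      obtain ⟨b, rfl⟩ := QuotientGroup.mk_surjective x
      rw [← connecting_eq_one_iff hS c,
        ← connecting_eq_of_leftRel hS (ptHom ℝ j b) c (QuotientGroup.eq.1 hx)]
      exact (connecting_eq_one_iff hS _).2 ⟨b, rfl⟩
  · refine (galH1Map_eq_one_iff hS h).trans ⟨fun ⟨c, hc⟩ => ⟨QuotientGroup.mk c, hc⟩, ?_⟩
    rintro ⟨x, hx⟩
    obtain ⟨c, rfl⟩ := QuotientGroup.mk_surjective x
    exact ⟨c, hx⟩
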